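/- \textbf{Definitions.} Graphs carry their path metric $d$. A map $\varphi\colon V(G)\to V(H)$ is a quasi-isometry if there are $\gamma\ge 1$, $c\ge 0$ with $\gamma^{-1}d_G(u,v)-c\le d_H(\varphi(u),\varphi(v))\le\gamma d_G(u,v)+c$ for all $u,v\in V(G)$, and every vertex of $H$ has distance at most $c$ from $\varphi(V(G))$; then $G$ is quasi-isometric to $H$. A graph is quasi-transitive if its automorphism group has finitely many orbits on its vertices. The ends of a graph are the classes of its rays (one-way infinite paths), where two rays are equivalent if for every finite vertex set $S$ they lie eventually in the same component of the graph minus $S$. For $p_1,p_2\in\mathbb N\cup\{\infty\}$, a tree with bipartition $V_1,V_2$ is $(p_1,p_2)$-semiregular if all vertices in $V_i$ have degree $p_i$ ($i=1,2$). Let $G_1,G_2$ be graphs and $T$ a $(p_1,p_2)$-semiregular tree with bipartition $V_1,V_2$. For $i=1,2$ let $S^i_k\subseteq V(G_i)$ ($1\le k\le p_i$, $k$ finite) be nonempty sets (the adhesion sets), and for all $k,\ell$ let $\varphi_{k,\ell}\colon S^1_k\to S^2_\ell$ be a bijection. Let $c\colon E(T)\to\{(k,\ell)\mid 1\le k\le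 p_1,\ 1\le \ell\le p_2\}$ be such that for every $v\in V_i$ the $i$-th coordinates of the labels $c(e)$ of the edges $e$ at $v$ run through all indices, each exactly once. Take a copy $G_i^v$ of $G_i$ for every $v\in V_i$, and for every edge $vu$ of $T$ with $v\in V_1$ and $c(vu)=(k,\ell)$ join every $x$ in the copy of $S^1_k$ in $G_1^v$ by a new edge to $\varphi_{k,\ell}(x)$ in the copy of $S^2_\ell$ in $G_2^u$. Contracting all new edges (and deleting loops and multiple edges) gives the tree amalgamation $G_1\ast_T G_2$. It has finite adhesion if all adhesion sets are finite. The identification size of a vertex $x$ of $G_1\ast_T G_2$ is the smallest number of vertices of a subtree $T_0$ of $T$ such that $x$ is obtained by contracting only new edges between vertices in the copies $G_i^v$ with $v\in V(T_0)$; the tree amalgamation has finite identification if the identification sizes of its vertices are bounded by some natural number. We say that it has quasi-transitive adhesion if for $i=1,2$ some group of automorphisms of $G_i$ acts with finitely many orbits on $V(G_i)$, permutes the set $\{S^i_k\}_k$ of adhesion sets of $G_i$, and has finitely many orbits on this set. \textbf{Theorem.} Let $F$, $G$ and $H$ be connected quasi-transitive locally finite graphs, and let $T$ and $T'$ be semiregular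 trees with infinitely many ends. If $F$ is quasi-isometric to $G$, then any locally finite tree amalgamations $F\ast_T H$ and $G\ast_{T'}H$ of finite adhesion, finite identification and quasi-transitive adhesion are quasi-isometric. -/

import Mathlib

namespace TreeAmalg

open SimpleGraph

universe u v w

/-- Every vertex has finitely many neighbours. -/
def IsLocallyFinite {V : Type u} (G : SimpleGraph V) : Prop :=
  ∀ x, (G.neighborSet x).Finite

/-- The automorphism group of `G` has finitely many orbits on the vertices. -/
def IsQuasiTransitive {V : Type u} (G : SimpleGraph V) : Prop :=
  ∃ R : Set V, R.Finite ∧ ∀ x, ∃ r ∈ R, ∃ g : G ≃g G, g r = x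

/-- Some group `Γ` of automorphisms of `G` acts with finitely many orbits on the vertices of `G`,
permutes the set `{S k | k}` of subsets of `V(G)`, and has finitely many orbits on this set. -/
def ActsQuasiTransitivelyOn {V : Type u} {ι : Type v} (G : SimpleGraph V) (S : ι → Set V) : Prop :=
  ∃ Γ : Subgroup (G ≃g G),
    (∃ R : Set V, R.Finite ∧ ∀ x, ∃ r ∈ R, ∃ g ∈ Γ, g r = x) ∧
    (∀ g ∈ Γ, ∀ k, ∃ k', g '' S k = S k') ∧
    (∃ K : Set ι, K.Finite ∧ ∀ k, ∃ r ∈ K, ∃ g ∈ Γ, g '' S r = S k)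

/-- `φ` is a quasi-isometry between the (connected) graphs `G` and `H` with their path metrics. -/
def IsQuasiIsometry {V : Type u} {W : Type v} (G : SimpleGraph V) (H : SimpleGraph W)
    (φ : V → W) : Prop :=
  ∃ γ c : ℝ, 1 ≤ γ ∧ 0 ≤ c ∧
    (∀ x y, γ⁻¹ * (G.dist x y : ℝ) - c ≤ (H.dist (φ x) (φ y) : ℝ) ∧
      (H.dist (φ x) (φ y) : ℝ) ≤ γ * (G.dist x y : ℝ) + c) ∧
    ∀ z, ∃ x, (H.dist z (φ x) : ℝ) ≤ c

/-- `G` is quasi-isometric to `H`. -/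
def QuasiIsometric {V : Type u} {W : Type v} (G : SimpleGraph V) (H : SimpleGraph W) : Prop :=
  ∃ φ : V → W, IsQuasiIsometry G H φ

/-! ### Ends -/

/-- A ray: a one-way infinite path. -/
structure Ray {V : Type u} (G : SimpleGraph V) where
  toFun : ℕ → V
  inj : Function.Injective toFun
  adj : ∀ n, G.Adj (toFun n) (toFun (n + 1))

/-- Two rays are equivalent if for every finite vertex set `S` they lie eventually in the same
component of `G - S`. -/
def Ray.Equiv {V : Type u} {G : SimpleGraph V} (r s : Ray G) : Prop :=
  ∀ S : Set V, S.Finite → ∃ N, ∀ m ≥ N, ∀ n ≥ N,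
    ∃ (hm : r.toFun m ∈ Sᶜ) (hn : s.toFun n ∈ Sᶜ),
      (G.induce Sᶜ).Reachable ⟨r.toFun m, hm⟩ ⟨s.toFun n, hn⟩

theorem Ray.Equiv.refl {V : Type u} {G : SimpleGraph V} (r : Ray G) : r.Equiv r := by
  intro S hS
  have hfin : (r.toFun ⁻¹' S).Finite := hS.preimage r.inj.injOn
  obtain ⟨M, hM⟩ := hfin.bddAbove
  have hout : ∀ m, M + 1 ≤ m → r.toFun m ∈ Sᶜ := by
    intro m hm hmS
    have := hM (show m ∈ r.toFun ⁻¹' S from hmS)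
    omega
  have key : ∀ m (hm : M + 1 ≤ m), (G.induce Sᶜ).Reachable
      ⟨r.toFun (M + 1), hout _ le_rfl⟩ ⟨r.toFun m, hout m hm⟩ := by
    intro m hm
    induction m, hm using Nat.le_induction with
    | base => exact Reachable.refl _
    | succ m hm ih =>
      refine ih.trans (Adj.reachable ?_)
      exact r.adj m
  exact ⟨M + 1, fun m hm n hn => ⟨hout m hm, hout n hn, (key m hm).symm.trans (key n hn)⟩⟩

/-- Equivalence of rays is an equivalence relation. -/
def raySetoid {V : Type u} (G : SimpleGraph V) : Setoid (Ray G) where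
  r := Ray.Equiv
  iseqv :=
    { refl := Ray.Equiv.refl
      symm := by
        intro r s h S hS
        obtain ⟨N, hN⟩ := h S hS
        refine ⟨N, fun m hm n hn => ?_⟩
        obtain ⟨h1, h2, h3⟩ := hN n hn m hm
        exact ⟨h2, h1, h3.symm⟩
      trans := by
        intro r s t h k S hS
        obtain ⟨N, hN⟩ := h S hS
        obtain ⟨M, hM⟩ := k S hS
        refine ⟨max N M, fun m hm n hn => ?_⟩
        obtain ⟨h1, _, h3⟩ := hN m (le_of_max_le_left hm) (max N M) (le_max_left _ _)
        obtain ⟨_, k2, k3⟩ := hM (max N M) (le_max_right _ _) n (le_of_max_le_right hn)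
        exact ⟨h1, k2, h3.trans k3⟩ }

/-- The ends of `G`: the equivalence classes of rays. -/
def Ends {V : Type u} (G : SimpleGraph V) : Type u := Quotient (raySetoid G)

/-! ### Tree amalgamations -/

/-- `T` is a `(p₁, p₂)`-semiregular tree, where `A` and its complement are the two classes `V₁`,
`V₂` of the canonical bipartition of its vertex set. -/
structure IsSemiregularTree {W : Type w} (T : SimpleGraph W) (A : Set W) (p₁ p₂ : ℕ∞) :
    Prop where
  isTree : T.IsTree
  bipartite : ∀ s t, T.Adj s t → (s ∈ A ↔ t ∉ A)
  degree₁ : ∀ t ∈ A, (T.neighborSet t).encard = p₁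
  degree₂ : ∀ t ∉ A, (T.neighborSet t).encard = p₂

/-- The index set with `p` elements (numbered from `0`), countably infinite for `p = ∞`. -/
abbrev Label (p : ℕ∞) : Type := {k : ℕ // (k : ℕ∞) < p}

/-- The data from which a tree amalgamation of `G₁` and `G₂` over the semiregular tree `T` is
formed: the adhesion sets `S₁ k ⊆ V(G₁)`, `S₂ l ⊆ V(G₂)`, the bijections `φ k l` between them
(so that all adhesion sets have the same cardinality), and the labelling `c` of the edges of `T`:
at every node in `V_i` the `i`-th coordinates of the labels of the incident edges run through all
indices, each exactly once. -/
structure AmalgamationData {V₁ : Type u} {V₂ : Type v} {W : Type w} (G₁ : SimpleGraph V₁)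
    (G₂ : SimpleGraph V₂) (T : SimpleGraph W) (A : Set W) (p₁ p₂ : ℕ∞) where
  S₁ : Label p₁ → Set V₁
  S₂ : Label p₂ → Set V₂
  nonempty₁ : ∀ k, (S₁ k).Nonempty
  nonempty₂ : ∀ l, (S₂ l).Nonempty
  φ : ∀ k l, S₁ k ≃ S₂ l
  c : T.edgeSet → Label p₁ × Label p₂
  c_bijective₁ : ∀ t ∈ A, Function.Bijective
    (fun e : {e : T.edgeSet // t ∈ (e : Sym2 W)} => (c e.1).1)
  c_bijective₂ : ∀ t ∉ A, Function.Bijective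
    (fun e : {e : T.edgeSet // t ∈ (e : Sym2 W)} => (c e.1).2)

namespace AmalgamationData

variable {V₁ : Type u} {V₂ : Type v} {W : Type w} {G₁ : SimpleGraph V₁} {G₂ : SimpleGraph V₂}
  {T : SimpleGraph W} {A : Set W} {p₁ p₂ : ℕ∞} (X : AmalgamationData G₁ G₂ T A p₁ p₂)

/-- The disjoint union of the vertex sets of the copies `G₁ᵗ` for `t ∈ V₁` and `G₂ᵗ` for
`t ∈ V₂`. -/
abbrev CopyVertex (_X : AmalgamationData G₁ G₂ T A p₁ p₂) : Type _ :=
  (↥A × V₁) ⊕ (↥Aᶜ × V₂)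

/-- The node of `T` whose copy contains the given vertex. -/
def node : X.CopyVertex → W
  | Sum.inl a => a.1
  | Sum.inr b => b.1

/-- The disjoint union of all the copies `G₁ᵗ` and `G₂ᵗ`. -/
def copies : SimpleGraph X.CopyVertex :=
  ((⊥ : SimpleGraph ↥A) □ G₁) ⊕g ((⊥ : SimpleGraph ↥Aᶜ) □ G₂)

/-- The new edges: for every edge `st` of `T` with `s ∈ V₁` and label `(k, l)`, each vertex `x` of
the copy of `S₁ k` in `G₁ˢ` is joined to the vertex `φ k l x` of the copy of `S₂ l` in `G₂ᵗ`. -/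
def newEdges : SimpleGraph X.CopyVertex :=
  SimpleGraph.fromRel fun a b =>
    ∃ (s : ↥A) (x : V₁) (t : ↥Aᶜ) (y : V₂), a = Sum.inl (s, x) ∧ b = Sum.inr (t, y) ∧
      ∃ (h : T.Adj s t) (hx : x ∈ X.S₁ (X.c ⟨s(s, t), h⟩).1),
        (X.φ (X.c ⟨s(s, t), h⟩).1 (X.c ⟨s(s, t), h⟩).2 ⟨x, hx⟩ : V₂) = y

/-- The graph `G₁ + G₂`: all the copies, together with the new edges. -/
def sumGraph : SimpleGraph X.CopyVertex := X.copies ⊔ X.newEdges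

/-- The vertices of the tree amalgamation: the sets of vertices of `G₁ + G₂` that become one vertex
when all new edges are contracted. -/
abbrev Vertex : Type _ := X.newEdges.ConnectedComponent

/-- The canonical map from `V(G₁ + G₂)` to the vertices of the tree amalgamation. -/
def ψ (a : X.CopyVertex) : X.Vertex := X.newEdges.connectedComponentMk a

/-- The tree amalgamation of `G₁` and `G₂` over `T`: `G₁ + G₂` with all new edges contracted. -/
def amalgam : SimpleGraph X.Vertex where
  Adj x y := x ≠ y ∧ ∃ a b, X.ψ a = x ∧ X.ψ b = y ∧ X.sumGraph.Adj a b
  symm := ⟨fun _ _ ⟨hne, a, b, ha, hb, h⟩ => ⟨hne.symm, b, a, hb, ha, h.symm⟩⟩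
  loopless := ⟨fun _ h => h.1 rfl⟩

/-- All adhesion sets are finite. -/
def FiniteAdhesion : Prop := (∀ k, (X.S₁ k).Finite) ∧ ∀ l, (X.S₂ l).Finite

/-- The vertex `x` of the tree amalgamation is obtained by contracting only new edges between
vertices in the copies at the nodes in `U`. -/
def ObtainedWithin (x : X.Vertex) (U : Set W) : Prop :=
  ∀ a b, X.ψ a = x → X.ψ b = x →
    ∃ (ha : a ∈ X.node ⁻¹' U) (hb : b ∈ X.node ⁻¹' U),
      (X.newEdges.induce (X.node ⁻¹' U)).Reachable ⟨a, ha⟩ ⟨b, hb⟩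

/-- The identification size of `x`: the smallest number of nodes of a subtree of `T` within which
all the contractions that lead to `x` take place. -/
noncomputable def identificationSize (x : X.Vertex) : ℕ∞ :=
  sInf {n | ∃ U : Set W, (T.induce U).IsTree ∧ U.encard = n ∧ X.ObtainedWithin x U}

/-- The identification sizes of the vertices are bounded by a natural number. -/
def FiniteIdentification : Prop := ∃ N : ℕ, ∀ x, X.identificationSize x ≤ N

/-- Each of the two factors has a group of automorphisms that acts quasi-transitively on the
factor and on the set of its adhesion sets. -/
def QuasiTransitiveAdhesion : Prop :=
  ActsQuasiTransitivelyOn G₁ X.S₁ ∧ ActsQuasiTransitivelyOn G₂ X.S₂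

end AmalgamationData

end TreeAmalg

/-! ### Coarse geometry of graphs -/

namespace TreeAmalg

open SimpleGraph Function

universe u v w x

/-! The strategy is to replace each amalgamation, up to coarse equivalence, by a tree of copies of
one graph `K`, and to show that the coarse type of such a tree depends only on the coarse type of
`K`. For connected graphs coarse equivalence is the same as quasi-isometry. Distances are bounded
through `edist`, since the disjoint sum of the two factors is disconnected.

Finite identification makes contracting the new edges a bounded change (`coarseEquiv_sumGraph`), so
what matters is a tree of alternating copies of the two factors. Choose a perfect matching of this
tree and merge the copies at matched nodes. Since the factors are quasi-transitive, automorphisms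
can move the attachment points of the parent edge and of the matching edge close to fixed base
points, provided the partner of a node is attached near its parent. Each merged pair becomes a copy
of `K`, the two factors joined by an edge between the base points (`Framing.coarseEquiv`).

In the resulting piece tree children are attached coarsely densely and with bounded multiplicity
(`Framing.uniformlyAttached`). Density uses that infinitely many ends force both degrees to be at
least `2` and not both equal to `2` (`IsSemiregularTree.degrees`); multiplicity is bounded by finite
identification and local finiteness of the factors.

Multiplicities are then irrelevant: after moving the attachments to a net, a Schröder–Bernstein
argument turns a tree with between `2` and `σ` children at each net point into the tree with exactly
`σ` (`coarseEquiv_words`). Nets transfer along coarse equivalences, so uniformly attached trees over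
coarsely equivalent graphs agree (`UniformlyAttached.coarseEquiv`). Finally a quasi-isometry of the
first factors extends to the joined graphs (`IsCoarseEquiv.sum_sup_edge`). -/

/-- `x` and `y` are joined by a walk of length at most `C`. -/
def Near {V : Type u} (G : SimpleGraph V) (C : ℕ) (x y : V) : Prop := G.edist x y ≤ (C : ℕ∞)

section Near

variable {V : Type u} {W : Type v} {G : SimpleGraph V} {H : SimpleGraph W} {x y z : V} {m n : ℕ}

theorem Near.refl (x : V) : Near G n x x := by simp [Near]

theorem Near.of_eq (h : x = y) : Near G n x y := h ▸ Near.refl x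

theorem Near.symm (h : Near G n x y) : Near G n y x := by
  unfold Near at *; rwa [edist_comm]

theorem Near.trans (h : Near G m x y) (h' : Near G n y z) : Near G (m + n) x z := by
  unfold Near at *
  exact G.edist_triangle.trans ((add_le_add h h').trans (by push_cast; rfl))

theorem Near.mono (h : Near G m x y) (hmn : m ≤ n) : Near G n x y :=
  le_trans (b := (m : ℕ∞)) h (by exact_mod_cast hmn)

theorem Near.of_adj (h : G.Adj x y) : Near G 1 x y := by
  unfold Near; rw [edist_eq_one_iff_adj.2 h]; rfl

theorem Near.anti {G' : SimpleGraph V} (hG : G ≤ G') (h : Near G n x y) : Near G' n x y :=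
  (edist_anti hG).trans h

theorem near_iff_exists_walk : Near G n x y ↔ ∃ p : G.Walk x y, p.length ≤ n := by
  constructor
  · intro h
    obtain ⟨p, hp⟩ := exists_walk_of_edist_ne_top
      (ne_top_of_le_ne_top (ENat.natCast_ne_top n) h : G.edist x y ≠ ⊤)
    refine ⟨p, ?_⟩
    unfold Near at h
    rw [← hp] at h
    exact_mod_cast h
  · rintro ⟨p, hp⟩
    exact (edist_le p).trans (by exact_mod_cast hp)

theorem near_zero_iff : Near G 0 x y ↔ x = y := by
  unfold Near; simp

theorem Near.map (f : V → W) {C : ℕ} (hf : ∀ a b, G.Adj a b → Near H C (f a) (f b))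
    (h : Near G n x y) : Near H (n * C) (f x) (f y) := by
  obtain ⟨p, hp⟩ := near_iff_exists_walk.1 h
  clear h
  induction p generalizing n with
  | nil => exact Near.refl _
  | cons h p ih =>
    rw [Walk.length_cons] at hp
    refine ((hf _ _ h).trans (ih (n := n - 1) (by omega))).mono ?_
    obtain ⟨k, rfl⟩ : ∃ k, n = k + 1 := ⟨n - 1, by omega⟩
    simp only [Nat.add_sub_cancel]
    ring_nf
    rfl

theorem Near.iso (g : G ≃g H) (h : Near G n x y) : Near H n (g x) (g y) := by
  simpa using h.map g (C := 1) (fun a b hab => Near.of_adj (g.map_rel_iff.2 hab))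

theorem near_iso_iff (g : G ≃g H) : Near H n (g x) (g y) ↔ Near G n x y :=
  ⟨fun h => by simpa using h.iso g.symm, fun h => h.iso g⟩

theorem Near.reachable (h : Near G n x y) : G.Reachable x y := by
  obtain ⟨p, -⟩ := near_iff_exists_walk.1 h
  exact ⟨p⟩

theorem exists_near_of_reachable (h : G.Reachable x y) : ∃ n, Near G n x y := by
  obtain ⟨p⟩ := h
  exact ⟨p.length, near_iff_exists_walk.2 ⟨p, le_rfl⟩⟩

theorem near_succ_iff : Near G (n + 1) x y ↔ x = y ∨ ∃ z, G.Adj x z ∧ Near G n z y := by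
  constructor
  · intro h
    obtain ⟨p, hp⟩ := near_iff_exists_walk.1 h
    cases p with
    | nil => exact Or.inl rfl
    | cons h p =>
      rw [Walk.length_cons] at hp
      exact Or.inr ⟨_, h, near_iff_exists_walk.2 ⟨p, by omega⟩⟩
  · rintro (rfl | ⟨z, h, h'⟩)
    · exact Near.refl _
    · exact ((Near.of_adj h).trans h').mono (by omega)

end Near

/-- The maps `f` and `g` are coarsely Lipschitz and coarsely inverse to each other. -/
structure IsCoarseEquiv {V : Type u} {W : Type v} (G : SimpleGraph V) (H : SimpleGraph W)
    (f : V → W) (g : W → V) (C : ℕ) : Prop where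
  map_adj : ∀ x y, G.Adj x y → Near H C (f x) (f y)
  inv_adj : ∀ x y, H.Adj x y → Near G C (g x) (g y)
  left_inv : ∀ x, Near G C (g (f x)) x
  right_inv : ∀ y, Near H C (f (g y)) y

/-- `G` and `H` are coarsely equivalent. -/
def CoarseEquiv {V : Type u} {W : Type v} (G : SimpleGraph V) (H : SimpleGraph W) : Prop :=
  ∃ f g C, IsCoarseEquiv G H f g C

section CoarseEquiv

variable {V : Type u} {W : Type v} {Z : Type w} {G : SimpleGraph V} {H : SimpleGraph W}
  {K : SimpleGraph Z}

theorem IsCoarseEquiv.symm {f : V → W} {g : W → V} {C : ℕ} (h : IsCoarseEquiv G H f g C) :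
    IsCoarseEquiv H G g f C := ⟨h.inv_adj, h.map_adj, h.right_inv, h.left_inv⟩

/-- The lower bound of a quasi-isometry: apply the Lipschitz map `g` and correct both ends by
`left_inv`. -/
theorem IsCoarseEquiv.near_of_near {f : V → W} {g : W → V} {C n : ℕ}
    (h : IsCoarseEquiv G H f g C) {x y : V} (hxy : Near H n (f x) (f y)) :
    Near G (C + n * C + C) x y :=
  ((h.left_inv x).symm.trans (hxy.map g h.inv_adj)).trans (h.left_inv y)

theorem CoarseEquiv.symm (h : CoarseEquiv G H) : CoarseEquiv H G := by
  obtain ⟨f, g, C, h⟩ := h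
  exact ⟨g, f, C, h.symm⟩

theorem CoarseEquiv.trans (h : CoarseEquiv G H) (h' : CoarseEquiv H K) : CoarseEquiv G K := by
  obtain ⟨f, g, C, h⟩ := h
  obtain ⟨f', g', C', h'⟩ := h'
  refine ⟨f' ∘ f, g ∘ g', C * C' + C' * C + C + C', ?_, ?_, ?_, ?_⟩
  · intro x y hxy
    exact ((h.map_adj x y hxy).map f' h'.map_adj).mono (by omega)
  · intro x y hxy
    exact ((h'.inv_adj x y hxy).map g h.inv_adj).mono (by omega)
  · intro x
    exact (((h'.left_inv (f x)).map g h.inv_adj).trans (h.left_inv x)).mono (by omega)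
  · intro x
    exact (((h.right_inv (g' x)).map f' h'.map_adj).trans (h'.right_inv x)).mono (by omega)

theorem CoarseEquiv.preconnected (h : CoarseEquiv G H) (hH : H.Preconnected) :
    G.Preconnected := by
  obtain ⟨f, g, C, h⟩ := h
  intro x y
  obtain ⟨n, hn⟩ := exists_near_of_reachable (hH (f x) (f y))
  exact (h.near_of_near hn).reachable

theorem Near.dist_le {x y : V} {n : ℕ} (h : Near G n x y) : G.dist x y ≤ n := by
  obtain ⟨p, hp⟩ := near_iff_exists_walk.1 h
  exact (SimpleGraph.dist_le p).trans hp

theorem near_dist (hG : G.Preconnected) (x y : V) : Near G (G.dist x y) x y := by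
  obtain ⟨p, hp⟩ := (hG x y).exists_walk_length_eq_dist
  exact near_iff_exists_walk.2 ⟨p, hp.le⟩

theorem CoarseEquiv.quasiIsometric (h : CoarseEquiv G H) (hH : H.Preconnected) :
    QuasiIsometric G H := by
  have hG := h.preconnected hH
  obtain ⟨f, g, C, h⟩ := h
  refine ⟨f, C + 1, 2 * C, by simp, by positivity, fun x y => ⟨?_, ?_⟩, fun z => ⟨g z, ?_⟩⟩
  · have h1 : G.dist x y ≤ C + H.dist (f x) (f y) * C + C :=
      (h.near_of_near (near_dist hH _ _)).dist_le
    have h2 : (G.dist x y : ℝ) ≤ C + H.dist (f x) (f y) * C + C := by exact_mod_cast h1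
    have hC : (0 : ℝ) < C + 1 := by positivity
    rw [sub_le_iff_le_add, inv_mul_le_iff₀ hC]
    have h3 : (0 : ℝ) ≤ H.dist (f x) (f y) := by positivity
    have h4 : (0 : ℝ) ≤ C := by positivity
    nlinarith [mul_nonneg h4 h4]
  · have h1 : H.dist (f x) (f y) ≤ G.dist x y * C :=
      ((near_dist hG x y).map f h.map_adj).dist_le
    have h2 : (H.dist (f x) (f y) : ℝ) ≤ G.dist x y * C := by exact_mod_cast h1
    have h3 : (0 : ℝ) ≤ G.dist x y := by positivity
    have h4 : (0 : ℝ) ≤ C := by positivity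
    nlinarith
  · have h1 : H.dist z (f (g z)) ≤ C := (h.right_inv z).symm.dist_le
    have h2 : (H.dist z (f (g z)) : ℝ) ≤ C := by exact_mod_cast h1
    have h4 : (0 : ℝ) ≤ C := by positivity
    linarith

theorem QuasiIsometric.coarseEquiv (hG : G.Preconnected) (hH : H.Preconnected)
    (h : QuasiIsometric G H) : CoarseEquiv G H := by
  obtain ⟨f, γ, c, hγ, hc, hf, hs⟩ := h
  choose g hg using hs
  have hγ0 : 0 < γ := by linarith
  have key : ∀ x y, (G.dist x y : ℝ) ≤ γ * (H.dist (f x) (f y) + c) := by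
    intro x y
    have := (hf x y).1
    rw [sub_le_iff_le_add, inv_mul_le_iff₀ hγ0] at this
    exact this
  have nat : ∀ (m : ℕ) (r : ℝ), (m : ℝ) ≤ r → m ≤ ⌈r⌉₊ := fun m r h => by
    exact_mod_cast h.trans (Nat.le_ceil r)
  -- One constant for all four conditions. In `1 + 3 * c`, one edge and two corrections `c` bound a
  -- distance between images, and the third `c` is the additive constant of the lower bound.
  obtain ⟨C, hC⟩ : ∃ C : ℕ, C = ⌈γ * (1 + 3 * c) + γ + 3 * c⌉₊ := ⟨_, rfl⟩
  have hHd : ∀ a b : W, ∀ r : ℝ, (H.dist a b : ℝ) ≤ r → r ≤ γ * (1 + 3 * c) + γ + 3 * c →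
      Near H C a b := fun a b r h h' =>
    (near_dist hH a b).mono (hC ▸ nat _ _ (h.trans h'))
  have hGd : ∀ a b : V, ∀ r : ℝ, (G.dist a b : ℝ) ≤ r → r ≤ γ * (1 + 3 * c) + γ + 3 * c →
      Near G C a b := fun a b r h h' =>
    (near_dist hG a b).mono (hC ▸ nat _ _ (h.trans h'))
  have hγc : 0 ≤ γ * c := by positivity
  refine ⟨f, g, C, ?_, ?_, ?_, ?_⟩
  · intro x y hxy
    have h1 := (hf x y).2
    rw [dist_eq_one_iff_adj.2 hxy] at h1
    exact hHd _ _ _ h1 (by push_cast; nlinarith)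
  · intro x y hxy
    have h1 := key (g x) (g y)
    have h2 : H.dist (f (g x)) (f (g y)) ≤ H.dist x (f (g x)) + 1 + H.dist y (f (g y)) := by
      have := ((near_dist hH x (f (g x))).symm.trans (Near.of_adj hxy)).trans
        (near_dist hH y (f (g y)))
      exact this.dist_le
    have h2' : (H.dist (f (g x)) (f (g y)) : ℝ) ≤
      H.dist x (f (g x)) + 1 + H.dist y (f (g y)) := by exact_mod_cast h2
    have h3 : (H.dist (f (g x)) (f (g y)) : ℝ) + c ≤ 1 + 3 * c := by
      linarith [hg x, hg y]
    refine hGd _ _ _ (h1.trans (mul_le_mul_of_nonneg_left h3 hγ0.le)) (by linarith)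
  · intro x
    have h1 := key (g (f x)) x
    have h2 := hg (f x)
    rw [dist_comm] at h2
    refine hGd _ _ _ (h1.trans (mul_le_mul_of_nonneg_left
      (show _ ≤ 1 + 3 * c by linarith) hγ0.le)) (by linarith)
  · intro y
    have h2 := hg y
    rw [dist_comm] at h2
    exact hHd _ _ _ h2 (by nlinarith)

end CoarseEquiv

/-! ### Trees of copies of a graph -/

/-- A rooted tree on `N`, given by the parent of every node, whose edges are attached at elements
of `V`. -/
structure PieceTree (N : Type u) (V : Type v) where
  root : N
  par : N → N
  att : N → V
  depth : N → ℕ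
  depth_par : ∀ v, v ≠ root → depth (par v) < depth v

namespace PieceTree

section Graph

variable {N : Type u} {V : Type v} {V' : Type w}

/-- The disjoint union of copies of `K`, one for every node, where the base point `b` in the copy at
`v` is joined to the point `att v` in the copy at the parent of `v`. -/
def graph (Z : PieceTree N V) (K : SimpleGraph V) (b : V) : SimpleGraph (N × V) :=
  SimpleGraph.fromRel fun p q => (p.1 = q.1 ∧ K.Adj p.2 q.2) ∨
    (q.1 ≠ Z.root ∧ p = (Z.par q.1, Z.att q.1) ∧ q.2 = b)

variable (Z : PieceTree N V) (K : SimpleGraph V) (b : V)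

theorem graph_adj_copy {t : N} {x y : V} (h : K.Adj x y) : (Z.graph K b).Adj (t, x) (t, y) := by
  refine (SimpleGraph.fromRel_adj _ _ _).2 ⟨?_, Or.inl (Or.inl ⟨rfl, h⟩)⟩
  simpa using h.ne

theorem par_ne {v : N} (hv : v ≠ Z.root) : Z.par v ≠ v := fun h => by
  have := Z.depth_par v hv
  rw [h] at this
  omega

theorem graph_adj_par {v : N} (hv : v ≠ Z.root) :
    (Z.graph K b).Adj (Z.par v, Z.att v) (v, b) := by
  refine (SimpleGraph.fromRel_adj _ _ _).2 ⟨?_, Or.inl (Or.inr ⟨hv, rfl, rfl⟩)⟩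
  intro h
  exact Z.par_ne hv (congrArg Prod.fst h)

theorem near_copy {t : N} {x y : V} {n : ℕ} (h : Near K n x y) :
    Near (Z.graph K b) n (t, x) (t, y) := by
  simpa using h.map (fun z => (t, z)) (C := 1)
    (fun a c hac => Near.of_adj (Z.graph_adj_copy K b hac))

/-- A map out of the graph of a piece tree is Lipschitz if it is so on the two kinds of edges. -/
theorem graph_lipschitz {X : Type*} {Q : SimpleGraph X} {C : ℕ} (f : N × V → X)
    (h₁ : ∀ t x y, K.Adj x y → Near Q C (f (t, x)) (f (t, y)))
    (h₂ : ∀ v, v ≠ Z.root → Near Q C (f (Z.par v, Z.att v)) (f (v, b))) :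
    ∀ p q, (Z.graph K b).Adj p q → Near Q C (f p) (f q) := by
  have key : ∀ p q : N × V, ((p.1 = q.1 ∧ K.Adj p.2 q.2) ∨
      (q.1 ≠ Z.root ∧ p = (Z.par q.1, Z.att q.1) ∧ q.2 = b)) → Near Q C (f p) (f q) := by
    rintro ⟨t, x⟩ ⟨s, y⟩ (⟨h, h'⟩ | ⟨h, h', h''⟩)
    · obtain rfl : t = s := h
      exact h₁ _ _ _ h'
    · obtain rfl : y = b := h''
      rw [h']
      exact h₂ _ h
  intro p q h
  obtain ⟨-, h | h⟩ := (SimpleGraph.fromRel_adj _ _ _).1 h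
  · exact key _ _ h
  · exact (key _ _ h).symm

/-- Piece trees with the same nodes over coarsely equivalent graphs are coarsely equivalent if their
edges are attached at points that correspond to each other up to a bounded distance. -/
theorem coarseEquiv_congr {K : SimpleGraph V} {K' : SimpleGraph V'} {f : V → V'} {g : V' → V}
    {C D : ℕ} (hf : IsCoarseEquiv K K' f g C) (Z : PieceTree N V) (Z' : PieceTree N V')
    (hroot : Z'.root = Z.root) (hpar : Z'.par = Z.par) (b : V) (b' : V')
    (hb : Near K' D (f b) b') (hatt : ∀ v, Near K' D (f (Z.att v)) (Z'.att v)) :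
    CoarseEquiv (Z.graph K b) (Z'.graph K' b') := by
  have back : ∀ x y, Near K' D (f x) y → Near K (D * C + C) (g y) x := fun x y h =>
    (h.symm.map g hf.inv_adj).trans (hf.left_inv x)
  refine ⟨fun p => (p.1, f p.2), fun p => (p.1, g p.2), C + (2 * D + 1) + (2 * (D * C + C) + 1),
    ?_, ?_, ?_, ?_⟩
  · refine Z.graph_lipschitz K b _ (fun t x y h => ?_) (fun v hv => ?_)
    · exact (Z'.near_copy K' b' (hf.map_adj x y h)).mono (by omega)
    · have h1 := Z'.near_copy K' b' (t := Z.par v) (hatt v)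
      have h2 := Near.of_adj (Z'.graph_adj_par K' b' (hroot ▸ hv))
      have h3 := Z'.near_copy K' b' (t := v) hb.symm
      rw [hpar] at h2
      exact ((h1.trans h2).trans h3).mono (by omega)
  · refine Z'.graph_lipschitz K' b' _ (fun t x y h => ?_) (fun v hv => ?_)
    · exact (Z.near_copy K b (hf.inv_adj x y h)).mono (by omega)
    · have h1 := Z.near_copy K b (t := Z.par v) (back _ _ (hatt v))
      have h2 := Near.of_adj (Z.graph_adj_par K b (hroot ▸ hv))
      have h3 := Z.near_copy K b (t := v) (back _ _ hb).symm
      rw [hpar]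
      exact ((h1.trans h2).trans h3).mono (by omega)
  · exact fun p => (Z.near_copy K b (hf.left_inv p.2)).mono (by omega)
  · exact fun p => (Z'.near_copy K' b' (hf.right_inv p.2)).mono (by omega)

theorem graph_preconnected (hK : K.Preconnected) : (Z.graph K b).Preconnected := by
  have key : ∀ n t x, Z.depth t ≤ n → (Z.graph K b).Reachable (t, x) (Z.root, b) := by
    intro n
    induction n with
    | zero =>
      intro t x ht
      have : t = Z.root := by
        by_contra h
        have := Z.depth_par t h
        omega
      subst this
      obtain ⟨k, hk⟩ := exists_near_of_reachable (hK x b)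
      exact (Z.near_copy K b hk).reachable
    | succ n ih =>
      intro t x ht
      obtain ⟨k, hk⟩ := exists_near_of_reachable (hK x b)
      have h1 := (Z.near_copy K b hk (t := t)).reachable
      by_cases h : t = Z.root
      · subst h; exact h1
      · have h2 := (Z.graph_adj_par K b h).symm.reachable
        have := Z.depth_par t h
        exact (h1.trans h2).trans (ih _ _ (by omega))
  intro p q
  exact (key _ p.1 p.2 le_rfl).trans (key _ q.1 q.2 le_rfl).symm

end Graph

/-- The piece tree whose nodes are the words over `I × Fin σ`. -/
def words {I : Type u} {V : Type v} (ι : I → V) (b : V) (σ : ℕ) :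
    PieceTree (List (I × Fin σ)) V where
  root := []
  par := List.tail
  att w := (w.head?.map fun s => ι s.1).getD b
  depth := List.length
  depth_par w hw := by
    cases w with
    | nil => exact absurd rfl hw
    | cons s w => simp

/-! ### Equalising the number of children at each point of attachment. -/

section Zones

variable {N : Type u} {I : Type v} {V : Type w} (Z : PieceTree N I)

/-- The children of the node `t` that are attached at `i`. -/
def childrenAt (t : N) (i : I) : Set N := {v | v ≠ Z.root ∧ Z.par v = t ∧ Z.att v = i}

/-- The piece tree with the points of attachment moved along `ι`. -/
def mapAtt (ι : I → V) : PieceTree N V where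
  root := Z.root
  par := Z.par
  att v := ι (Z.att v)
  depth := Z.depth
  depth_par := Z.depth_par

variable {Z}

/-- If between `2` and `σ` children of every node are attached at every `i`, then the slots
`(t, i, j)` with `j < σ` correspond bijectively to the non-root nodes, where `(t, i, j)` corresponds
to a child of `t` attached at `i` or to a bounded iterate of a fixed section of `par` at such a
child. -/
theorem exists_bijective_slots {σ : ℕ} (i₀ : I)
    (hle : ∀ t i, (Z.childrenAt t i).encard ≤ σ) (hge : ∀ t i, 2 ≤ (Z.childrenAt t i).encard) :
    ∃ (zero : N → N) (one : N → I → N),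
      (∀ t, zero t ∈ Z.childrenAt t i₀) ∧ (∀ t i, one t i ∈ Z.childrenAt t i) ∧
      (∀ (k k' : ℕ) (t t' : N) (i i' : I),
        zero^[k] (one t i) = zero^[k'] (one t' i') → k = k' ∧ t = t' ∧ i = i') ∧
      ∃ h : N × I × Fin σ → {v // v ≠ Z.root}, Bijective h ∧
        ∀ s, (h s : N) = zero^[s.2.2] (one s.1 s.2.1) ∨
          (s.1 = Z.par (h s) ∧ s.2.1 = Z.att (h s)) := by
  -- Two children are needed because at `i₀` one is reserved for `zero`, and `one` must avoid it;
  -- this keeps the chains `zero^[k] (one t i)` pairwise disjoint.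
  have hex : ∀ t i, ∃ x y, x ∈ Z.childrenAt t i ∧ y ∈ Z.childrenAt t i ∧ x ≠ y := fun t i =>
    Set.one_lt_encard_iff.1 (lt_of_lt_of_le (by norm_num) (hge t i))
  choose c₀ c₁ h₀ h₁ hne using hex
  obtain ⟨zero, hzero⟩ : ∃ zero : N → N, zero = fun t => c₀ t i₀ := ⟨_, rfl⟩
  have hz : ∀ t, zero t ∈ Z.childrenAt t i₀ := fun t => by rw [hzero]; exact h₀ t i₀
  have hzinj : Injective zero := fun a b h => by
    have h1 := (hz a).2.1
    have h2 := (hz b).2.1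
    rw [← h1, ← h2, h]
  have hz1 : ∀ t t' i, zero t ≠ c₁ t' i := by
    intro t t' i h
    have h1 := hz t
    rw [h] at h1
    obtain rfl : t' = t := (h₁ t' i).2.1.symm.trans h1.2.1
    obtain rfl : i = i₀ := (h₁ t' i).2.2.symm.trans h1.2.2
    exact hne t' i (by rw [← h, hzero])
  have hmem : ∀ (t : N) (i : I) (k : ℕ), zero^[k] (c₁ t i) ≠ Z.root := by
    intro t i k
    cases k with
    | zero => exact (h₁ t i).1
    | succ k => rw [iterate_succ_apply']; exact (hz _).1
  have hainj : ∀ (k k' : ℕ) (t t' : N) (i i' : I),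
      zero^[k] (c₁ t i) = zero^[k'] (c₁ t' i') → k = k' ∧ t = t' ∧ i = i' := by
    intro k
    induction k with
    | zero =>
      intro k' t t' i i' h
      cases k' with
      | zero =>
        have h : c₁ t i = c₁ t' i' := h
        refine ⟨rfl, ?_, ?_⟩
        · rw [← (h₁ t i).2.1, ← (h₁ t' i').2.1, h]
        · rw [← (h₁ t i).2.2, ← (h₁ t' i').2.2, h]
      | succ k' =>
        rw [iterate_succ_apply'] at h
        exact absurd h.symm (hz1 _ _ _)
    | succ k ih =>
      intro k' t t' i i' h
      cases k' with
      | zero =>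
        rw [iterate_succ_apply'] at h
        exact absurd h (hz1 _ _ _)
      | succ k' =>
        rw [iterate_succ_apply', iterate_succ_apply'] at h
        obtain ⟨h1, h2⟩ := ih _ _ _ _ _ (hzinj h)
        exact ⟨by rw [h1], h2⟩
  -- Numbering the children at each `(t, i)` by `Fin σ` injects nodes into slots; the chains inject
  -- slots into nodes.
  have hidx : ∀ t i, ∃ e : N → Fin σ, Set.InjOn e (Z.childrenAt t i) := by
    intro t i
    have hfin : (Z.childrenAt t i).Finite := Set.finite_of_encard_le_coe (hle t i)
    have h2 : (Z.childrenAt t i).encard ≤ (Set.univ : Set (Fin σ)).encard := by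
      simpa using hle t i
    have : Nonempty (Fin σ) := by
      have h3 := (hge t i).trans (hle t i)
      have : 2 ≤ σ := by exact_mod_cast h3
      exact ⟨⟨0, by omega⟩⟩
    obtain ⟨e, -, he⟩ := hfin.exists_injOn_of_encard_le h2
    exact ⟨e, he⟩
  choose idx hidx using hidx
  refine ⟨zero, c₁, hz, h₁, hainj, ?_⟩
  have hf : Injective (fun s : N × I × Fin σ =>
      (⟨zero^[s.2.2] (c₁ s.1 s.2.1), hmem _ _ _⟩ : {v // v ≠ Z.root})) := by
    rintro ⟨t, i, k⟩ ⟨t', i', k'⟩ h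
    obtain ⟨h1, h2, h3⟩ := hainj _ _ _ _ _ _ (congrArg Subtype.val h)
    exact Prod.ext h2 (Prod.ext h3 (Fin.ext h1))
  have hg : Injective (fun v : {v // v ≠ Z.root} =>
      (Z.par v, Z.att v, idx (Z.par v) (Z.att v) v)) := by
    rintro ⟨v, hv⟩ ⟨v', hv'⟩ h
    simp only [Prod.mk.injEq] at h
    obtain ⟨h1, h2, h3⟩ := h
    rw [← h1, ← h2] at h3
    exact Subtype.ext (hidx _ _ ⟨hv, rfl, rfl⟩ ⟨hv', h1.symm, h2.symm⟩ h3)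
  -- The relational form is essential: every matched pair comes from one of the two injections, so
  -- slot and node stay at bounded distance.
  obtain ⟨h, hb, hR⟩ := Embedding.schroeder_bernstein_of_rel hf hg
    (fun s v => (v : N) = zero^[s.2.2] (c₁ s.1 s.2.1) ∨ (s.1 = Z.par v ∧ s.2.1 = Z.att v))
    (fun s => Or.inl rfl) (fun v => Or.inr ⟨rfl, rfl⟩)
  exact ⟨h, hb, hR⟩

/-- A piece tree in which between `2` and `σ` children of every node are attached at every `i` is
coarsely equivalent to the one in which exactly `σ` children are attached at each `i`. -/
theorem coarseEquiv_words {σ : ℕ} (i₀ : I) (ι : I → V) (K : SimpleGraph V)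
    (hle : ∀ t i, (Z.childrenAt t i).encard ≤ σ) (hge : ∀ t i, 2 ≤ (Z.childrenAt t i).encard) :
    CoarseEquiv ((words ι (ι i₀) σ).graph K (ι i₀)) ((Z.mapAtt ι).graph K (ι i₀)) := by
  obtain ⟨zero, one, hzero, hone, hcode, h, hbij, hh⟩ := exists_bijective_slots i₀ hle hge
  have hchain : ∀ t i k, Z.depth t < Z.depth (zero^[k] (one t i)) := by
    intro t i k
    induction k with
    | zero =>
      have := Z.depth_par _ (hone t i).1
      rw [(hone t i).2.1] at this
      exact this
    | succ k ih =>
      rw [iterate_succ_apply']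
      have := Z.depth_par _ (hzero (zero^[k] (one t i))).1
      rw [(hzero _).2.1] at this
      omega
  -- Depth strictly increases from the node of a slot to the node assigned to it, so tracing slots
  -- backwards from any node ends at the root; hence surjectivity of `Ψ`.
  have hdepth : ∀ s, Z.depth s.1 < Z.depth (h s) := by
    intro s
    rcases hh s with h1 | ⟨h1, -⟩
    · rw [h1]; exact hchain _ _ _
    · rw [h1]; exact Z.depth_par _ (h s).2
  obtain ⟨Ψ, hΨ0, hΨ1⟩ : ∃ Ψ : List (I × Fin σ) → N, Ψ [] = Z.root ∧
      ∀ s w, Ψ (s :: w) = h (Ψ w, s) :=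
    ⟨fun w => w.foldr (fun s t => (h (t, s) : N)) Z.root, rfl, fun _ _ => rfl⟩
  have hinj : Injective Ψ := by
    intro w
    induction w with
    | nil =>
      intro w' e
      cases w' with
      | nil => rfl
      | cons s w' =>
        rw [hΨ0, hΨ1] at e
        exact absurd e.symm (h _).2
    | cons s w ih =>
      intro w' e
      cases w' with
      | nil =>
        rw [hΨ0, hΨ1] at e
        exact absurd e (h _).2
      | cons s' w' =>
        rw [hΨ1, hΨ1] at e
        have e' := hbij.1 (Subtype.ext e)
        simp only [Prod.mk.injEq] at e'
        rw [ih e'.1, e'.2]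
  have hsurj : Surjective Ψ := by
    have : ∀ n v, Z.depth v ≤ n → ∃ w, Ψ w = v := by
      intro n
      induction n with
      | zero =>
        intro v hv
        by_cases hr : v = Z.root
        · exact ⟨[], by rw [hΨ0, hr]⟩
        · have := Z.depth_par v hr
          omega
      | succ n ih =>
        intro v hv
        by_cases hr : v = Z.root
        · exact ⟨[], by rw [hΨ0, hr]⟩
        · obtain ⟨⟨t, s⟩, hs⟩ := hbij.2 ⟨v, hr⟩
          have h1 := hdepth (t, s)
          rw [hs] at h1
          obtain ⟨w, hw⟩ := ih t (by simp only at h1; omega)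
          exact ⟨s :: w, by rw [hΨ1, hw, hs]⟩
    exact fun v => this _ v le_rfl
  obtain ⟨Φ, hΦΨ, hΨΦ⟩ : ∃ Φ : N → List (I × Fin σ), (∀ w, Φ (Ψ w) = w) ∧ ∀ v, Ψ (Φ v) = v :=
    ⟨(Equiv.ofBijective Ψ ⟨hinj, hsurj⟩).symm,
      (Equiv.ofBijective Ψ ⟨hinj, hsurj⟩).symm_apply_apply,
      (Equiv.ofBijective Ψ ⟨hinj, hsurj⟩).apply_symm_apply⟩
  have hΦh : ∀ s, Φ (h s) = s.2 :: Φ s.1 := by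
    intro s
    rw [← hΦΨ (s.2 :: Φ s.1), hΨ1, hΨΦ]
  set A := (words ι (ι i₀) σ).graph K (ι i₀) with hA
  set B := (Z.mapAtt ι).graph K (ι i₀) with hB
  have hBstep : ∀ v, v ≠ Z.root → Near B 1 (Z.par v, ι (Z.att v)) (v, ι i₀) := fun v hv =>
    Near.of_adj ((Z.mapAtt ι).graph_adj_par K (ι i₀) hv)
  -- All `zero` children are attached at `i₀`, that is, at the base point where the previous copy
  -- was entered, so a chain costs one edge per step.
  have hBchain : ∀ t i k, Near B (k + 1) (t, ι i) (zero^[k] (one t i), ι i₀) := by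
    intro t i k
    induction k with
    | zero =>
      have := hBstep _ (hone t i).1
      rw [(hone t i).2.1, (hone t i).2.2] at this
      exact this
    | succ k ih =>
      rw [iterate_succ_apply']
      have := hBstep _ (hzero (zero^[k] (one t i))).1
      rw [(hzero _).2.1, (hzero _).2.2] at this
      exact (ih.trans this).mono (by omega)
  have hAstep : ∀ s, Near A 1 (Φ s.1, ι s.2.1) (Φ (h s), ι i₀) := by
    intro s
    rw [hΦh]
    exact Near.of_adj ((words ι (ι i₀) σ).graph_adj_par K (ι i₀) (v := s.2 :: Φ s.1)
      (by simp [words]))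
  -- If a chain node was assigned by the chain injection, `hcode` identifies its slot as `(t, i,
  -- k)`, one step from `(Φ t, ι i)`; otherwise it stays below its true parent, the previous chain
  -- node, and induction applies.
  have hAchain : ∀ t i k, k < σ →
      Near A (k + 1) (Φ t, ι i) (Φ (zero^[k] (one t i)), ι i₀) := by
    intro t i k
    induction k with
    | zero =>
      intro _
      obtain ⟨s, hs⟩ := hbij.2 ⟨one t i, (hone t i).1⟩
      have h1 := hAstep s
      rw [hs] at h1
      rcases hh s with h2 | ⟨h2, h3⟩
      · rw [hs] at h2
        obtain ⟨-, h4, h5⟩ := hcode 0 _ _ _ _ _ h2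
        rw [← h4, ← h5] at h1
        exact h1
      · rw [h2, h3, hs] at h1
        simp only [(hone t i).2.1, (hone t i).2.2] at h1
        exact h1
    | succ k ih =>
      intro hk
      have hv := hzero (zero^[k] (one t i))
      rw [← iterate_succ_apply' zero] at hv
      obtain ⟨s, hs⟩ := hbij.2 ⟨_, hv.1⟩
      have h1 := hAstep s
      rw [hs] at h1
      rcases hh s with h2 | ⟨h2, h3⟩
      · rw [hs] at h2
        obtain ⟨-, h4, h5⟩ := hcode _ _ _ _ _ _ h2
        rw [← h4, ← h5] at h1
        exact h1.mono (by omega)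
      · rw [h2, h3, hs] at h1
        simp only [hv.2.1, hv.2.2] at h1
        exact ((ih (by omega)).trans h1).mono (by omega)
  refine ⟨fun p => (Ψ p.1, p.2), fun p => (Φ p.1, p.2), σ + 1, ?_, ?_, ?_, ?_⟩
  · refine graph_lipschitz _ K _ _ (fun t x y hxy => ?_) (fun v hv => ?_)
    · exact Near.mono (Near.of_adj ((Z.mapAtt ι).graph_adj_copy K (ι i₀) hxy)) (by omega)
    · cases v with
      | nil => exact absurd rfl hv
      | cons s w =>
        change Near B (σ + 1) (Ψ w, ι s.1) (Ψ (s :: w), ι i₀)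
        rw [hΨ1]
        rcases hh (Ψ w, s) with h2 | ⟨h2, h3⟩
        · rw [h2]
          exact (hBchain _ _ _).mono (by have := s.2.2; simp only; omega)
        · have h4 := hBstep _ (h (Ψ w, s)).2
          rw [← h2, ← h3] at h4
          exact h4.mono (by omega)
  · refine graph_lipschitz _ K _ _ (fun t x y hxy => ?_) (fun v hv => ?_)
    · exact Near.mono (Near.of_adj ((words ι (ι i₀) σ).graph_adj_copy K (ι i₀) hxy)) (by omega)
    · change Near A (σ + 1) (Φ (Z.par v), ι (Z.att v)) (Φ v, ι i₀)
      obtain ⟨⟨t, i, k⟩, hs⟩ := hbij.2 ⟨v, hv⟩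
      rcases hh (t, i, k) with h2 | ⟨h2, h3⟩
      · rw [hs] at h2
        simp only at h2
        obtain ⟨k, hk⟩ := k
        cases k with
        | zero =>
          have h2 : v = one t i := h2
          rw [h2, (hone t i).2.1, (hone t i).2.2]
          exact (hAchain t i 0 hk).mono (by omega)
        -- The parent of `v` is the previous chain node, within `k + 1` of `(Φ t, ι i)`, while `v`
        -- itself fills a slot of `t` at `i`; as `k + 1 < σ` the total `k + 2` is at most `σ + 1`.
        | succ k =>
          simp only at h2
          rw [h2, iterate_succ_apply', (hzero _).2.1, (hzero _).2.2, ← iterate_succ_apply' zero]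
          have h4 := (hAchain t i k (by omega)).symm
          have h5 := hAstep (t, i, ⟨k + 1, hk⟩)
          rw [hs] at h5
          simp only at h5
          rw [h2] at h5
          exact (h4.trans h5).mono (by omega)
      · have h5 := hAstep (t, i, k)
        rw [hs] at h2 h3 h5
        simp only at h2 h3 h5
        rw [h2, h3] at h5
        exact h5.mono (by omega)
  · exact fun p => Near.of_eq (Prod.ext (hΦΨ _) rfl)
  · exact fun p => Near.of_eq (Prod.ext (hΨΦ _) rfl)

end Zones

end PieceTree

/-! ### Nets, and comparison of uniformly attached piece trees. -/

theorem exists_separated_net {V : Type u} (K : SimpleGraph V) (r : ℕ) :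
    ∃ S : Set V, (∀ x ∈ S, ∀ y ∈ S, Near K r x y → x = y) ∧ ∀ x, ∃ s ∈ S, Near K r x s := by
  obtain ⟨S, hS⟩ := zorn_subset {S : Set V | ∀ x ∈ S, ∀ y ∈ S, Near K r x y → x = y} (by
    intro c hc hchain
    refine ⟨⋃₀ c, ?_, fun s hs => Set.subset_sUnion_of_mem hs⟩
    rintro x ⟨s, hs, hx⟩ y ⟨t, ht, hy⟩ hxy
    rcases hchain.total hs ht with h | h
    · exact hc ht _ (h hx) _ hy hxy
    · exact hc hs _ hx _ (h hy) hxy)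
  refine ⟨S, hS.prop, fun x => ?_⟩
  by_contra! h
  have hx : x ∉ S := fun hx => h x hx (Near.refl x)
  refine hx (hS.le_of_ge (y := insert x S) ?_ (Set.subset_insert x S) (Set.mem_insert x S))
  rintro y (rfl | hy) z (rfl | hz) hyz
  · rfl
  · exact absurd hyz (h z hz)
  · exact absurd hyz.symm (h y hy)
  · exact hS.prop y hy z hz hyz

/-- The balls of radius `R` about net points are disjoint, so each can be sent to its centre; this
preserves lower bounds on the number of children, while other points may go to any net point within
`D`. -/
theorem exists_retraction_to_net {V : Type u} {I : Type v} {K : SimpleGraph V} {ι : I → V}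
    {R D : ℕ} (hR : R ≤ D) (hsep : ∀ i j, Near K (2 * R) (ι i) (ι j) → i = j)
    (hcov : ∀ x, ∃ i, Near K D x (ι i)) :
    ∃ q : V → I, (∀ x, Near K D x (ι (q x))) ∧ ∀ x i, Near K R x (ι i) → q x = i := by
  have : ∀ x, ∃ j, Near K D x (ι j) ∧ ∀ i, Near K R x (ι i) → j = i := by
    intro x
    by_cases h : ∃ i, Near K R x (ι i)
    · obtain ⟨i, hi⟩ := h
      exact ⟨i, hi.mono hR, fun j hj => hsep _ _ ((hi.symm.trans hj).mono (by omega))⟩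
    · obtain ⟨i, hi⟩ := hcov x
      exact ⟨i, hi, fun j hj => absurd ⟨j, hj⟩ h⟩
  choose q h1 h2 using this
  exact ⟨q, h1, h2⟩

namespace PieceTree

variable {N : Type u} {V : Type v}

/-- The children of `t` that are attached at distance at most `R` from `x`. -/
def childrenNear (Z : PieceTree N V) (K : SimpleGraph V) (R : ℕ) (t : N) (x : V) : Set N :=
  {v | v ≠ Z.root ∧ Z.par v = t ∧ Near K R (Z.att v) x}

/-- The children of every node are attached coarsely densely, with bounded multiplicity. -/
def UniformlyAttached (Z : PieceTree N V) (K : SimpleGraph V) : Prop :=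
  (∃ R, ∀ t x, 2 ≤ (Z.childrenNear K R t x).encard) ∧
    ∀ R, ∃ M : ℕ, ∀ t x, (Z.childrenNear K R t x).encard ≤ M

/-- Retracting the attachments to the net moves them by at most `D`. Every `σ` above the
multiplicity bound is allowed, so that two different trees can later be compared with the same `σ`.
-/
theorem exists_coarseEquiv_words {I : Type w} {Z : PieceTree N V} {K : SimpleGraph V} {ι : I → V}
    {R D n : ℕ} {b : V} (hR : R ≤ D) (hsep : ∀ i j, Near K (2 * R) (ι i) (ι j) → i = j)
    (hcov : ∀ x, ∃ i, Near K D x (ι i))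
    (hge : ∀ t x, 2 ≤ (Z.childrenNear K R t x).encard)
    (hle : ∀ R, ∃ M : ℕ, ∀ t x, (Z.childrenNear K R t x).encard ≤ M)
    {i₀ : I} (hb : Near K n b (ι i₀)) :
    ∃ σ₀, ∀ σ, σ₀ ≤ σ →
      CoarseEquiv ((words ι (ι i₀) σ).graph K (ι i₀)) (Z.graph K b) := by
  obtain ⟨q, hq, hqR⟩ := exists_retraction_to_net hR hsep hcov
  obtain ⟨M, hM⟩ := hle D
  refine ⟨M, fun σ hσ => ?_⟩
  refine (coarseEquiv_words (Z := Z.mapAtt q) i₀ ι K (fun t i => ?_) (fun t i => ?_)).trans ?_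
  · refine (Set.encard_le_encard ?_).trans ((hM t (ι i)).trans (by exact_mod_cast hσ))
    rintro v ⟨h1, h2, h3⟩
    exact ⟨h1, h2, h3 ▸ hq (Z.att v)⟩
  · refine (hge t (ι i)).trans (Set.encard_le_encard ?_)
    rintro v ⟨h1, h2, h3⟩
    exact ⟨h1, h2, hqR _ _ h3⟩
  · have hid : IsCoarseEquiv K K id id 1 :=
      ⟨fun x y h => Near.of_adj h, fun x y h => Near.of_adj h, fun x => Near.refl x,
        fun x => Near.refl x⟩
    exact coarseEquiv_congr (D := D + n) hid ((Z.mapAtt q).mapAtt ι) Z rfl rfl _ _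
      (hb.symm.mono (by omega)) (fun v => (hq _).symm.mono (by omega))

/-- Two uniformly attached piece trees over coarsely equivalent graphs are coarsely equivalent. -/
theorem UniformlyAttached.coarseEquiv {N' : Type*} {V' : Type*} {Z : PieceTree N V}
    {Z' : PieceTree N' V'} {K : SimpleGraph V} {K' : SimpleGraph V'} {f : V → V'} {g : V' → V}
    {C D : ℕ} (hf : IsCoarseEquiv K K' f g C) (hZ : Z.UniformlyAttached K)
    (hZ' : Z'.UniformlyAttached K') {b : V} {b' : V'} (hb : Near K' D (f b) b') :
    CoarseEquiv (Z.graph K b) (Z'.graph K' b') := by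
  obtain ⟨⟨R, hR⟩, hM⟩ := hZ
  obtain ⟨⟨R', hR'⟩, hM'⟩ := hZ'
  -- The summand `C + 2 * R' * C + C` is the bound of `near_of_near` at `2 * R'`: it makes the
  -- images under `f` a `2 * R'`-separated family, so that a single net serves both trees.
  obtain ⟨S, hS, hScov⟩ := exists_separated_net K (2 * R + (C + 2 * R' * C + C))
  set r := 2 * R + (C + 2 * R' * C + C) with hr
  obtain ⟨s₀, hs₀, hbs⟩ := hScov b
  have hcov : ∀ x, ∃ i : S, Near K r x i := fun x => by
    obtain ⟨s, hs, h⟩ := hScov x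
    exact ⟨⟨s, hs⟩, h⟩
  obtain ⟨σ₁, h₁⟩ := exists_coarseEquiv_words (Z := Z) (ι := fun s : S => (s : V)) (i₀ := ⟨s₀, hs₀⟩)
    (D := r) (by omega)
    (fun i j h => Subtype.ext (hS _ i.2 _ j.2 (h.mono (by omega)))) hcov hR hM hbs
  obtain ⟨σ₂, h₂⟩ := exists_coarseEquiv_words (Z := Z') (ι := fun s : S => f s) (i₀ := ⟨s₀, hs₀⟩)
    (D := R' + (C + r * C)) (n := D + r * C) (b := b') (by omega)
    (fun i j h => Subtype.ext (hS _ i.2 _ j.2 ((hf.near_of_near h).mono (by omega))))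
    (fun y => by
      obtain ⟨i, hi⟩ := hcov (g y)
      exact ⟨i, ((hf.right_inv y).symm.trans (hi.map f hf.map_adj)).mono (by omega)⟩) hR' hM'
    (hb.symm.trans (hbs.map f hf.map_adj))
  refine ((h₁ (max σ₁ σ₂) (le_max_left _ _)).symm.trans ?_).trans
    (h₂ (max σ₁ σ₂) (le_max_right _ _))
  refine coarseEquiv_congr (D := 0) hf _ _ rfl rfl _ _ (Near.refl _) (fun v => Near.of_eq ?_)
  cases v <;> rfl

end PieceTree

/-! ### Rooted trees and a perfect matching -/

/-- `par` maps every node of the tree `T` other than the root `r` to its parent. -/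
structure IsParentMap {W : Type u} (T : SimpleGraph W) (r : W) (par : W → W) : Prop where
  adj : ∀ t, t ≠ r → T.Adj t (par t)
  dist_eq : ∀ t, t ≠ r → T.dist r t = T.dist r (par t) + 1
  par_eq : ∀ t u, T.Adj t u → (t = r ∨ u ≠ par t) → u ≠ r ∧ par u = t

section Tree

variable {W : Type u} {T : SimpleGraph W}

theorem exists_adj_dist_add_one (hT : T.Connected) {r t : W} (h : t ≠ r) :
    ∃ u, T.Adj t u ∧ T.dist r t = T.dist r u + 1 := by
  obtain ⟨p, hp⟩ := hT.exists_walk_length_eq_dist t r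
  cases p with
  | nil => exact absurd rfl h
  | cons hadj p =>
    rename_i u
    refine ⟨u, hadj, ?_⟩
    rw [Walk.length_cons] at hp
    have h1 := T.dist_le p
    have h2 := hT.dist_triangle (u := t) (v := u) (w := r)
    rw [dist_eq_one_iff_adj.2 hadj] at h2
    rw [dist_comm, dist_comm (u := r) (v := u)]
    omega

/-- Extending geodesics from `r` to `u` and to `u'` by the edge to `t` gives two paths from `r` to
`t`; they coincide in a tree, hence so do their penultimate vertices. -/
theorem eq_of_adj_of_dist (hT : T.IsTree) {r t u u' : W} (hu : T.Adj t u) (hu' : T.Adj t u')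
    (h : T.dist r t = T.dist r u + 1) (h' : T.dist r t = T.dist r u' + 1) : u = u' := by
  have key : ∀ u, T.Adj t u → T.dist r t = T.dist r u + 1 →
      ∃ p : T.Walk r t, p.IsPath ∧ p.penultimate = u := by
    intro u hu h
    obtain ⟨p, hp⟩ := hT.connected.exists_walk_length_eq_dist r u
    refine ⟨p.concat hu.symm, ?_, p.penultimate_concat _⟩
    apply Walk.isPath_of_length_eq_dist
    rw [Walk.length_concat, hp, h]
  obtain ⟨p, hp, rfl⟩ := key u hu h
  obtain ⟨q, hq, rfl⟩ := key u' hu' h'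
  rw [(hT.existsUnique_path r t).unique hp hq]

theorem exists_isParentMap (hT : T.IsTree) (r : W) : ∃ par, IsParentMap T r par := by
  have : ∀ t, ∃ u, t ≠ r → T.Adj t u ∧ T.dist r t = T.dist r u + 1 := by
    intro t
    by_cases h : t = r
    · exact ⟨t, fun h' => absurd h h'⟩
    · obtain ⟨u, hu⟩ := exists_adj_dist_add_one hT.connected h
      exact ⟨u, fun _ => hu⟩
  choose par hpar using this
  refine ⟨par, fun t ht => (hpar t ht).1, fun t ht => (hpar t ht).2, fun t u htu h => ?_⟩
  have hu : T.dist r u = T.dist r t + 1 := by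
    rcases hT.dist_eq_dist_add_one_of_adj r htu with h1 | h1
    · rcases h with rfl | h
      · rw [dist_self] at h1; omega
      · have ht : t ≠ r := by rintro rfl; rw [dist_self] at h1; omega
        exact absurd (eq_of_adj_of_dist hT htu (hpar t ht).1 h1 (hpar t ht).2) h
    · exact h1
  have hur : u ≠ r := by rintro rfl; rw [dist_self] at hu; omega
  exact ⟨hur, eq_of_adj_of_dist hT (hpar u hur).1 htu.symm (hpar u hur).2 hu⟩

namespace IsParentMap

variable {r : W} {par m : W → W}

theorem mate_ne_root (hp : IsParentMap T r par)
    (hm : ∀ t, T.Adj t (m t) ∧ (t ≠ r → m t ≠ par t)) (t : W) : m t ≠ r ∧ par (m t) = t := by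
  refine hp.par_eq t (m t) (hm t).1 ?_
  by_cases h : t = r
  · exact Or.inl h
  · exact Or.inr ((hm t).2 h)

/-- Greedy choice of a perfect matching of a rooted tree: the upper ends `t` of its edges are
matched with their child `m t`. -/
theorem exists_upper (hp : IsParentMap T r par) : ∃ top : W → Prop, top r ∧
    ∀ t, t ≠ r → (top t ↔ ¬ (top (par t) ∧ t = m (par t))) := by
  -- Recursion on depth; `aux n t` is only meaningful for `n` equal to the distance from `r` to `t`.
  let aux : ℕ → W → Prop := fun n =>
    n.rec (fun _ => True) (fun _ f t => ¬ (f (par t) ∧ t = m (par t)))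
  refine ⟨fun t => aux (T.dist r t) t, ?_, fun t ht => ?_⟩
  · simp only [dist_self]
    trivial
  · simp only [hp.dist_eq t ht]
    rfl

end IsParentMap

end Tree

/-! ### Trees of spaces -/

/-- Copies of the two parts of a graph `K₀` arranged along a bipartite tree `T`: the part of `K₀`
used at a node is determined by the side of the node, and the neighbours of a node correspond to the
labels on its side, each of which has a point of attachment in `K₀`. The graph `Q` on the set `P` of
all points of all copies joins copies at adjacent nodes only near the respective points of
attachment, up to distance `D`. -/
structure SpaceTree (W : Type u) (V : Type v) (L : Type w) (P : Type x) where
  T : SimpleGraph W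
  K₀ : SimpleGraph V
  Q : SimpleGraph P
  D : ℕ
  sideW : W → Bool
  sideV : V → Bool
  sideL : L → Bool
  att : L → V
  lab : W → W → L
  node : P → W
  val : P → V
  isTree : T.IsTree
  side_adj : ∀ s t, T.Adj s t → sideW t = !sideW s
  side_K₀ : ∀ y z, K₀.Adj y z → sideV y = sideV z
  side_att : ∀ l, sideV (att l) = sideL l
  side_lab : ∀ s t, T.Adj s t → sideL (lab s t) = sideW s
  lab_inj : ∀ s t t', T.Adj s t → T.Adj s t' → lab s t = lab s t' → t = t'
  lab_surj : ∀ s l, sideL l = sideW s → ∃ t, T.Adj s t ∧ lab s t = l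
  side_val : ∀ a, sideV (val a) = sideW (node a)
  exists_point : ∀ t z, sideV z = sideW t → ∃ a, node a = t ∧ val a = z
  point_ext : ∀ a b, node a = node b → val a = val b → a = b
  adj_cases : ∀ a b, Q.Adj a b → (node a = node b ∧ K₀.Adj (val a) (val b)) ∨
    (T.Adj (node a) (node b) ∧ Near K₀ D (val a) (att (lab (node a) (node b))) ∧
      Near K₀ D (val b) (att (lab (node b) (node a))))
  adj_copy : ∀ a b, node a = node b → K₀.Adj (val a) (val b) → Q.Adj a b
  exists_adj : ∀ s t, T.Adj s t → ∃ a b, node a = s ∧ node b = t ∧ Q.Adj a b ∧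
    val a = att (lab s t) ∧ Near K₀ D (val b) (att (lab t s))

namespace SpaceTree

variable {W : Type u} {V : Type v} {L : Type w} {P : Type x} (A : SpaceTree W V L P)

/-- The two parts of `K₀` joined by an edge between their base points. -/
def joined (β : Bool → V) : SimpleGraph V := A.K₀ ⊔ SimpleGraph.edge (β true) (β false)

/-- The geometric hypotheses on the two parts of `K₀` and their points of attachment. -/
structure Tame (β : Bool → V) : Prop where
  side_base : ∀ i, A.sideV (β i) = i
  align : ∃ C, ∀ z, ∃ g : A.K₀ ≃g A.K₀, (∀ y, A.sideV (g y) = A.sideV y) ∧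
    Near A.K₀ C (g z) (β (A.sideV z))
  count_le : ∀ R, ∃ M : ℕ, ∀ z, {l | Near A.K₀ R z (A.att l)}.encard ≤ M
  le_count : ∃ (n : Bool → ℕ) (R : ℕ), (∀ i, 2 ≤ n i) ∧ 5 ≤ n true + n false ∧
    (∀ z, (n (A.sideV z) : ℕ∞) ≤ {l | Near A.K₀ R z (A.att l)}.encard) ∧
    ∀ i, 5 ≤ n i ∨ ∀ y z, A.sideV y = i → A.sideV z = i → Near A.K₀ R y z

/-- A perfect matching of the tree, given by the upper ends `top` of its edges and their partners
`m`, together with automorphisms of `K₀` that move the points of attachment towards the parent and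
towards the partner close to the base points. -/
structure Framing (β : Bool → V) where
  r : W
  par : W → W
  m : W → W
  top : W → Prop
  g : W → (A.K₀ ≃g A.K₀)
  C : ℕ
  isParentMap : IsParentMap A.T r par
  m_adj : ∀ t, A.T.Adj t (m t)
  m_ne_root : ∀ t, m t ≠ r
  par_m : ∀ t, par (m t) = t
  top_root : top r
  top_iff : ∀ t, t ≠ r → (top t ↔ ¬ (top (par t) ∧ t = m (par t)))
  side_g : ∀ t y, A.sideV (g t y) = A.sideV y
  near_par : ∀ t, t ≠ r → Near A.K₀ C (g t (A.att (A.lab t (par t)))) (β (A.sideW t))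
  near_m : ∀ t, Near A.K₀ C (g t (A.att (A.lab t (m t)))) (β (A.sideW t))

variable {A} {β : Bool → V}

theorem side_of_near {n : ℕ} {y z : V} (h : Near A.K₀ n y z) : A.sideV y = A.sideV z := by
  obtain ⟨p, -⟩ := near_iff_exists_walk.1 h
  clear h
  induction p with
  | nil => rfl
  | cons h p ih => exact (A.side_K₀ _ _ h).trans ih

theorem near_points {n : ℕ} {a b : P} (hn : A.node a = A.node b)
    (h : Near A.K₀ n (A.val a) (A.val b)) : Near A.Q n a b := by
  induction n generalizing a with
  | zero => exact Near.of_eq (A.point_ext a b hn (near_zero_iff.1 h))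
  | succ n ih =>
    rcases near_succ_iff.1 h with h | ⟨z, h, h'⟩
    · exact Near.of_eq (A.point_ext a b hn h)
    · obtain ⟨c, hc, rfl⟩ := A.exists_point (A.node a) z
        ((A.side_K₀ _ _ h).symm.trans (A.side_val a))
      exact near_succ_iff.2 (Or.inr ⟨c, A.adj_copy a c hc.symm h, ih (hc.trans hn) h'⟩)

/-- The edge supplied by `exists_adj` starts exactly at the attachment point but ends only within
`D` of the other one; hence `D + 1`. -/
theorem near_att {a b : P} (h : A.T.Adj (A.node a) (A.node b))
    (ha : A.val a = A.att (A.lab (A.node a) (A.node b)))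
    (hb : A.val b = A.att (A.lab (A.node b) (A.node a))) : Near A.Q (A.D + 1) a b := by
  obtain ⟨a', b', ha', hb', hadj, hva, hvb⟩ := A.exists_adj _ _ h
  obtain rfl : a' = a := A.point_ext _ _ ha' (hva.trans ha.symm)
  refine ((Near.of_adj hadj).trans (near_points (n := A.D) hb' ?_)).mono (by omega)
  rw [hb]
  exact hvb

/-- A non-root node takes as partner another neighbour attached within `R` of its parent; this
exists because every ball of radius `R` meets at least two labels. One automorphism aligning the
parent attachment then aligns that of the partner too, with error `R + C`. -/
theorem Tame.exists_framing (h : A.Tame β) : Nonempty (A.Framing β) := by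
  obtain ⟨r⟩ := A.isTree.connected.nonempty
  obtain ⟨par, hpar⟩ := exists_isParentMap A.isTree r
  obtain ⟨n, R, hn2, -, hnR, -⟩ := h.le_count
  obtain ⟨C, hC⟩ := h.align
  choose G hGs hGn using hC
  have hlabel : ∀ z l₀, ∃ l, l ≠ l₀ ∧ Near A.K₀ R z (A.att l) := by
    intro z l₀
    have h1 : 1 < {l | Near A.K₀ R z (A.att l)}.encard :=
      lt_of_lt_of_le (by exact_mod_cast hn2 (A.sideV z)) (hnR z)
    obtain ⟨a, b, ha, hb, hab⟩ := Set.one_lt_encard_iff.1 h1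
    by_cases hal : a = l₀
    · exact ⟨b, fun hbl => hab (hal.trans hbl.symm), hb⟩
    · exact ⟨a, hal, ha⟩
  have hm : ∀ t, ∃ u, A.T.Adj t u ∧ (t ≠ r → u ≠ par t ∧
      Near A.K₀ R (A.att (A.lab t (par t))) (A.att (A.lab t u))) := by
    intro t
    by_cases ht : t = r
    · obtain ⟨l₀⟩ : Nonempty L := by
        have h1 : {l | Near A.K₀ R (β true) (A.att l)}.Nonempty := by
          rw [← Set.encard_pos]
          exact lt_of_lt_of_le (by have := hn2 (A.sideV (β true)); exact_mod_cast (by omega))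
            (hnR (β true))
        exact ⟨h1.some⟩
      obtain ⟨l, -, hl⟩ := hlabel (β (A.sideW t)) l₀
      have hs := side_of_near hl
      rw [h.side_base, A.side_att] at hs
      obtain ⟨u, hu, -⟩ := A.lab_surj t l hs.symm
      exact ⟨u, hu, fun h => absurd ht h⟩
    · obtain ⟨l, hl, hl'⟩ := hlabel (A.att (A.lab t (par t))) (A.lab t (par t))
      have hs := side_of_near hl'
      rw [A.side_att, A.side_att, A.side_lab _ _ (hpar.adj t ht)] at hs
      obtain ⟨u, hu, rfl⟩ := A.lab_surj t l hs.symm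
      exact ⟨u, hu, fun _ => ⟨fun h => hl (by rw [h]), hl'⟩⟩
  choose m hm using hm
  have hmate := fun t => hpar.mate_ne_root (m := m)
    (fun t => ⟨(hm t).1, fun ht => ((hm t).2 ht).1⟩) t
  obtain ⟨top, htop, htop'⟩ := hpar.exists_upper (m := m)
  classical
  -- The label whose attachment point is moved to the base point; the root has no parent edge, so
  -- its matching edge is used.
  let ℓ : W → L := fun t => if t = r then A.lab t (m t) else A.lab t (par t)
  have hℓ : ∀ t, A.sideV (A.att (ℓ t)) = A.sideW t := by
    intro t
    rw [A.side_att]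
    by_cases ht : t = r
    · simp only [ℓ, if_pos ht]; exact A.side_lab _ _ (hm t).1
    · simp only [ℓ, if_neg ht]; exact A.side_lab _ _ (hpar.adj t ht)
  have hg : ∀ t, Near A.K₀ C (G (A.att (ℓ t)) (A.att (ℓ t))) (β (A.sideW t)) := fun t => by
    have := hGn (A.att (ℓ t))
    rwa [hℓ] at this
  refine ⟨⟨r, par, m, top, fun t => G (A.att (ℓ t)), R + C, hpar, fun t => (hm t).1,
    fun t => (hmate t).1, fun t => (hmate t).2, htop, htop', fun t y => hGs _ _,
    fun t ht => ?_, fun t => ?_⟩⟩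
  · have h1 := hg t
    have h2 : ℓ t = A.lab t (par t) := if_neg ht
    rw [h2] at h1
    simp only [h2]
    exact h1.mono (by omega)
  · have h1 := hg t
    by_cases ht : t = r
    · have h2 : ℓ t = A.lab t (m t) := if_pos ht
      rw [h2] at h1
      simp only [h2]
      exact h1.mono (by omega)
    · have h2 : ℓ t = A.lab t (par t) := if_neg ht
      rw [h2] at h1
      simp only [h2]
      exact ((((hm t).2 ht).2.symm.iso _).trans h1)

/-! ### Merging the copies at matched nodes. -/

namespace Framing

variable (F : A.Framing β)

open Classical in
/-- The upper end of the matching edge at `t`. -/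
noncomputable def up (t : W) : W := if F.top t then t else F.par t

variable {F}

theorem up_of_top {t : W} (h : F.top t) : F.up t = t := if_pos h

theorem up_of_not_top {t : W} (h : ¬ F.top t) : F.up t = F.par t := if_neg h

theorem eq_m_of_not_top {t : W} (h : ¬ F.top t) :
    t ≠ F.r ∧ F.top (F.par t) ∧ t = F.m (F.par t) := by
  have hr : t ≠ F.r := by rintro rfl; exact h F.top_root
  rw [F.top_iff t hr, not_not] at h
  exact ⟨hr, h⟩

theorem not_top_m {t : W} (h : F.top t) : ¬ F.top (F.m t) := by
  rw [F.top_iff _ (F.m_ne_root t), not_not, F.par_m]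
  exact ⟨h, rfl⟩

theorem top_up (t : W) : F.top (F.up t) := by
  by_cases h : F.top t
  · rwa [up_of_top h]
  · rw [up_of_not_top h]
    exact (eq_m_of_not_top h).2.1

theorem up_m {t : W} (h : F.top t) : F.up (F.m t) = t := by
  rw [up_of_not_top (not_top_m h), F.par_m]

theorem eq_or_eq_m_up (t : W) : t = F.up t ∨ t = F.m (F.up t) := by
  by_cases h : F.top t
  · rw [up_of_top h]; exact Or.inl rfl
  · rw [up_of_not_top h]
    exact Or.inr (eq_m_of_not_top h).2.2

theorem side_m (t : W) : A.sideW (F.m t) = !A.sideW t := A.side_adj _ _ (F.m_adj t)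

variable (F)

/-- The node matched at `e` on the same side as `z`. -/
def nodeAt (e : W) (z : V) : W := if A.sideV z = A.sideW e then e else F.m e

variable {F}

theorem side_nodeAt (e : W) (z : V) : A.sideW (F.nodeAt e z) = A.sideV z := by
  unfold nodeAt
  split_ifs with h
  · exact h.symm
  · rw [side_m]
    cases h1 : A.sideV z <;> cases h2 : A.sideW e <;> simp_all

theorem up_nodeAt {e : W} (he : F.top e) (z : V) : F.up (F.nodeAt e z) = e := by
  unfold nodeAt
  split_ifs with h
  · exact up_of_top he
  · exact up_m he

theorem nodeAt_up {t : W} {z : V} (h : A.sideV z = A.sideW t) : F.nodeAt (F.up t) z = t := by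
  unfold nodeAt
  rcases F.eq_or_eq_m_up t with h1 | h1
  · rw [← h1, if_pos h]
  · have h2 := F.side_m (F.up t)
    rw [← h1] at h2
    rw [if_neg, ← h1]
    rw [h, h2]
    simp

variable (F)

theorem depth_up_le (t : W) : A.T.dist F.r (F.up t) ≤ A.T.dist F.r t := by
  by_cases h : F.top t
  · rw [up_of_top h]
  · rw [up_of_not_top h]
    have := F.isParentMap.dist_eq t (eq_m_of_not_top h).1
    omega

/-- The piece tree obtained by merging the pieces at matched nodes. -/
noncomputable def pieceTree : PieceTree {t // F.top t} V where
  root := ⟨F.r, F.top_root⟩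
  par v := ⟨F.up (F.par v), F.top_up _⟩
  att v := F.g (F.par v) (A.att (A.lab (F.par v) v))
  depth v := A.T.dist F.r v
  depth_par v hv := by
    have h1 := F.isParentMap.dist_eq v (fun h => hv (Subtype.ext h))
    have h2 := F.depth_up_le (F.par v)
    simp only
    omega

theorem near_base (i j : Bool) : Near (A.joined β) 1 (β i) (β j) := by
  by_cases hβ : β true = β false
  · have : β i = β j := by cases i <;> cases j <;> simp [hβ]
    exact Near.of_eq this
  have h : Near (A.joined β) 1 (β true) (β false) := Near.of_adj
    (Or.inr (by rw [SimpleGraph.edge_adj]; exact ⟨Or.inl ⟨rfl, rfl⟩, hβ⟩))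
  cases i <;> cases j
  · exact Near.refl _
  · exact h.symm
  · exact h
  · exact Near.refl _

theorem near_joined {n : ℕ} {y z : V} (h : Near A.K₀ n y z) : Near (A.joined β) n y z :=
  h.anti le_sup_left

/-- The map `f` is a bijection on points, since the side of a point in a merged copy tells which of
the two matched nodes it comes from. Only Lipschitz bounds remain: tree edges between matched nodes
correspond to the edge between base points, and the others to edges of the piece tree. -/
theorem coarseEquiv (hβ : ∀ i, A.sideV (β i) = i) :
    CoarseEquiv A.Q (F.pieceTree.graph (A.joined β) (β true)) := by
  set Z := F.pieceTree.graph (A.joined β) (β true) with hZ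
  let f : P → {t // F.top t} × V := fun a =>
    (⟨F.up (A.node a), F.top_up _⟩, F.g (A.node a) (A.val a))
  have hex : ∀ p : {t // F.top t} × V, ∃ a, A.node a = F.nodeAt p.1 p.2 ∧
      A.val a = (F.g (F.nodeAt p.1 p.2)).symm p.2 := by
    intro p
    apply A.exists_point
    rw [side_nodeAt, ← F.side_g (F.nodeAt p.1 p.2) ((F.g (F.nodeAt p.1 p.2)).symm p.2),
      RelIso.apply_symm_apply]
  choose k hk₁ hk₂ using hex
  have hfk : ∀ p, f (k p) = p := by
    intro p
    refine Prod.ext (Subtype.ext ?_) ?_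
    · change F.up (A.node (k p)) = p.1
      rw [hk₁, up_nodeAt p.1.2]
    · change F.g (A.node (k p)) (A.val (k p)) = p.2
      rw [hk₂, hk₁, RelIso.apply_symm_apply]
  have hkf : ∀ a, k (f a) = a := by
    intro a
    have h1 : F.nodeAt (f a).1 (f a).2 = A.node a :=
      nodeAt_up ((F.side_g _ _).trans (A.side_val a))
    apply A.point_ext
    · rw [hk₁, h1]
    · rw [hk₂, h1]
      exact (F.g _).symm_apply_apply _
  have hcopy : ∀ (e : {t // F.top t}) {n : ℕ} {y z : V}, Near (A.joined β) n y z →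
      Near Z n (e, y) (e, z) := fun e n y z h => F.pieceTree.near_copy _ _ h
  have hcopy₀ : ∀ (e : {t // F.top t}) (t : W) {n : ℕ} {y z : V}, Near A.K₀ n y z →
      Near Z n (e, F.g t y) (e, F.g t z) := fun e t n y z h => hcopy e (near_joined (h.iso _))
  -- two points of copies at adjacent nodes
  have hcross : ∀ a b, A.T.Adj (A.node a) (A.node b) → A.node b ≠ F.r →
      F.par (A.node b) = A.node a → Near A.K₀ A.D (A.val a) (A.att (A.lab (A.node a) (A.node b))) →
      Near A.K₀ A.D (A.val b) (A.att (A.lab (A.node b) (A.node a))) →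
      Near Z (2 * A.D + 2 * F.C + 2) (f a) (f b) := by
    intro a b hab hbr hpar ha hb
    have h1 := hcopy₀ ⟨F.up (A.node a), F.top_up _⟩ (A.node a) ha
    have h5 := hcopy₀ ⟨F.up (A.node b), F.top_up _⟩ (A.node b) hb.symm
    have h4 := F.near_par (A.node b) hbr
    rw [hpar] at h4
    have h4 := hcopy ⟨F.up (A.node b), F.top_up _⟩ (near_joined h4.symm)
    by_cases ht : F.top (A.node b)
    · have h2 : Near Z 1 _ _ := Near.of_adj (F.pieceTree.graph_adj_par (A.joined β) (β true)
        (v := ⟨A.node b, ht⟩) (fun h => hbr (congrArg Subtype.val h)))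
      -- Piece tree edges always enter at `β true`, whereas the parent attachment is near the base
      -- point on the side of the node; the edge of `joined` bridges the two.
      have h3 := hcopy ⟨A.node b, ht⟩ (near_base true (A.sideW (A.node b)))
      have e1 : (⟨A.node b, ht⟩ : {t // F.top t}) = ⟨F.up (A.node b), F.top_up _⟩ :=
        Subtype.ext (up_of_top ht).symm
      have e2 : F.pieceTree.par ⟨A.node b, ht⟩ = ⟨F.up (A.node a), F.top_up _⟩ :=
        Subtype.ext (by simp [pieceTree, hpar])
      have e3 : F.pieceTree.att ⟨A.node b, ht⟩ =
          F.g (A.node a) (A.att (A.lab (A.node a) (A.node b))) := by simp [pieceTree, hpar]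
      rw [e2, e3, e1] at h2
      rw [e1] at h3
      exact ((((h1.trans h2).trans h3).trans h4).trans h5).mono (by omega)
    · obtain ⟨-, htp, hmp⟩ := eq_m_of_not_top ht
      rw [hpar] at htp hmp
      have e1 : (⟨F.up (A.node b), F.top_up _⟩ : {t // F.top t}) =
          ⟨F.up (A.node a), F.top_up _⟩ :=
        Subtype.ext (by
          change F.up (A.node b) = F.up (A.node a)
          rw [up_of_not_top ht, hpar, up_of_top htp])
      have h2 := F.near_m (A.node a)
      rw [← hmp] at h2
      have h2 := hcopy ⟨F.up (A.node a), F.top_up _⟩ (near_joined h2)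
      have h3 := hcopy ⟨F.up (A.node a), F.top_up _⟩
        (near_base (A.sideW (A.node a)) (A.sideW (A.node b)))
      rw [e1] at h4 h5
      have h6 := ((((h1.trans h2).trans h3).trans h4).trans h5)
      change Near Z _ (_, _) (_, _)
      rw [e1]
      exact h6.mono (by omega)
  -- the points of attachment and the base points
  have hback : ∀ a b, A.T.Adj (A.node a) (A.node b) → A.node b ≠ F.r →
      F.par (A.node b) = A.node a → ∀ n,
      Near A.K₀ n (F.g (A.node a) (A.val a))
        (F.g (A.node a) (A.att (A.lab (A.node a) (A.node b)))) →
      F.g (A.node b) (A.val b) = β (A.sideW (A.node b)) →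
      Near A.Q (n + (A.D + 1) + F.C) a b := by
    intro a b hab hbr hpar n ha hb
    obtain ⟨a', ha₁, ha₂⟩ := A.exists_point (A.node a) (A.att (A.lab (A.node a) (A.node b)))
      (by rw [A.side_att, A.side_lab _ _ hab])
    obtain ⟨b', hb₁, hb₂⟩ := A.exists_point (A.node b) (A.att (A.lab (A.node b) (A.node a)))
      (by rw [A.side_att, A.side_lab _ _ hab.symm])
    have h1 : Near A.Q n a a' := near_points ha₁.symm (by rw [ha₂]; exact (near_iso_iff _).1 ha)
    have h2 := near_att (a := a') (b := b') (by rw [ha₁, hb₁]; exact hab) (by rw [ha₂, ha₁, hb₁])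
      (by rw [hb₂, ha₁, hb₁])
    have h3 := F.near_par (A.node b) hbr
    rw [← hb, hpar] at h3
    have h3 : Near A.Q F.C b' b := near_points hb₁ (by rw [hb₂]; exact (near_iso_iff _).1 h3)
    exact (h1.trans h2).trans h3
  -- The edge between base points is realised in `A.Q` by the new edges between matched copies.
  have hwedge : ∀ e : {t // F.top t}, Near A.Q (2 * F.C + A.D + 1) (k (e, β (A.sideW e)))
      (k (e, β (A.sideW (F.m e)))) := by
    intro e
    have n1 : F.nodeAt e (β (A.sideW e)) = e := if_pos (hβ _)
    have n2 : F.nodeAt e (β (A.sideW (F.m e))) = F.m e :=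
      if_neg (by rw [hβ, side_m]; simp)
    have h1 := hk₁ (e, β (A.sideW e))
    have h2 := hk₁ (e, β (A.sideW (F.m e)))
    simp only [n1, n2] at h1 h2
    refine (hback _ _ (by rw [h1, h2]; exact F.m_adj _) (by rw [h2]; exact F.m_ne_root _)
      (by rw [h1, h2]; exact F.par_m _) F.C ?_ ?_).mono (by omega)
    · rw [hk₂, h1, h2]
      simp only [n1]
      rw [RelIso.apply_symm_apply]
      exact (F.near_m e).symm
    · rw [hk₂, h2]
      simp only [n2]
      rw [RelIso.apply_symm_apply]
  have hwedge' : ∀ (e : {t // F.top t}) (i j : Bool),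
      Near A.Q (2 * F.C + A.D + 1) (k (e, β i)) (k (e, β j)) := by
    intro e i j
    have h := hwedge e
    rw [side_m] at h
    generalize A.sideW e = s at h
    cases i <;> cases j <;> cases s <;>
      first | exact Near.refl _ | exact h | exact h.symm
  refine ⟨f, k, 2 * A.D + 4 * F.C + 4, ?_, ?_, ?_, ?_⟩
  · intro a b hab
    rcases A.adj_cases a b hab with ⟨h1, h2⟩ | ⟨h1, h2, h3⟩
    · have := F.pieceTree.near_copy (A.joined β) (β true) (t := ⟨F.up (A.node a), F.top_up _⟩)
        (near_joined (β := β) ((Near.of_adj h2).iso (F.g (A.node a))))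
      have e : f b = (⟨F.up (A.node a), F.top_up _⟩, F.g (A.node a) (A.val b)) := by
        simp only [f, h1]
      rw [e]
      exact Near.mono this (by omega)
    · by_cases hc : A.node a = F.r ∨ A.node b ≠ F.par (A.node a)
      · obtain ⟨h4, h5⟩ := F.isParentMap.par_eq _ _ h1 hc
        exact (hcross a b h1 h4 h5 h2 h3).mono (by omega)
      · push Not at hc
        exact (hcross b a h1.symm hc.1 hc.2.symm h3 h2).symm.mono (by omega)
  · refine PieceTree.graph_lipschitz _ _ _ _ (fun e y z h => ?_) (fun v hv => ?_)
    · rcases h with h | h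
      · have hn : F.nodeAt e y = F.nodeAt e z := by
          unfold nodeAt
          rw [A.side_K₀ _ _ h]
        refine (near_points (n := 1) (by rw [hk₁, hk₁]; exact hn) ?_).mono (by omega)
        rw [hk₂, hk₂]
        simp only [hn]
        exact (Near.of_adj h).iso _
      · obtain ⟨⟨rfl, rfl⟩ | ⟨rfl, rfl⟩, -⟩ := (SimpleGraph.edge_adj _ _ _ _).1 h
        · exact (hwedge' e _ _).mono (by omega)
        · exact (hwedge' e _ _).mono (by omega)
    · have hvr : (v : W) ≠ F.r := fun h => hv (Subtype.ext h)
      have hadj := (F.isParentMap.adj v hvr).symm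
      obtain ⟨a, ha₁, ha₂⟩ := A.exists_point (F.par v) (A.att (A.lab (F.par v) v))
        (by rw [A.side_att, A.side_lab _ _ hadj])
      have hfa : f a = (F.pieceTree.par v, F.pieceTree.att v) := by
        refine Prod.ext (Subtype.ext ?_) ?_
        · change F.up (A.node a) = F.up (F.par v)
          rw [ha₁]
        · change F.g (A.node a) (A.val a) = F.g (F.par v) (A.att (A.lab (F.par v) v))
          rw [ha₁, ha₂]
      have n1 : F.nodeAt v (β (A.sideW v)) = v := if_pos (hβ _)
      have h1 := hk₁ (v, β (A.sideW v))
      simp only [n1] at h1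
      rw [← hfa, hkf]
      refine ((hback a (k (v, β (A.sideW v))) (by rw [ha₁, h1]; exact hadj) (by rw [h1]; exact hvr)
        (by rw [h1, ha₁]) 0 ?_ ?_).trans (hwedge' v (A.sideW v) true)).mono (by omega)
      · rw [ha₁, ha₂, h1]
        exact Near.refl _
      · rw [hk₂, h1]
        simp only [n1]
        rw [RelIso.apply_symm_apply]
  · exact fun a => Near.of_eq (hkf a)
  · exact fun p => Near.of_eq (hfk p)

end Framing

end SpaceTree

/-! ### Counting the children of merged copies. -/

namespace SpaceTree

variable {W : Type u} {V : Type v} {L : Type w} {P : Type x} {A : SpaceTree W V L P}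
  {β : Bool → V}

/-- A walk that leaves `A.K₀` must first reach an end of the added edge, so up to then it is a walk
in `A.K₀` to a base point. -/
theorem near_of_near_joined {n : ℕ} {y z : V} (h : Near (A.joined β) n y z) :
    Near A.K₀ n y z ∨ Near A.K₀ n y (β true) ∨ Near A.K₀ n y (β false) := by
  induction n generalizing y with
  | zero => exact Or.inl (Near.of_eq (near_zero_iff.1 h))
  | succ n ih =>
    rcases near_succ_iff.1 h with h | ⟨c, h, h'⟩
    · exact Or.inl (Near.of_eq h)
    · rcases h with h | h
      · have h1 : ∀ {c'}, Near A.K₀ n c c' → Near A.K₀ (n + 1) y c' := fun h2 =>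
          ((Near.of_adj h).trans h2).mono (by omega)
        exact (ih h').imp h1 (Or.imp h1 h1)
      · obtain ⟨⟨rfl, rfl⟩ | ⟨rfl, rfl⟩, -⟩ := (SimpleGraph.edge_adj _ _ _ _).1 h
        · exact Or.inr (Or.inl (Near.refl _))
        · exact Or.inr (Or.inr (Near.refl _))

namespace Framing

variable (F : A.Framing β)

/-- The neighbours of `s` attached at distance at most `R` from `z`. -/
def nbrsNear (K : SimpleGraph V) (R : ℕ) (s : W) (z : V) : Set W :=
  {u | A.T.Adj s u ∧ Near K R (F.g s (A.att (A.lab s u))) z}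

/-- Being near `z` in `joined` means being near `z` or one of the two base points in `A.K₀`; each
contributes at most `M` labels. -/
theorem encard_nbrsNear_le {R M : ℕ} (hM : ∀ z, {l | Near A.K₀ R z (A.att l)}.encard ≤ M)
    (s : W) (z : V) : (F.nbrsNear (A.joined β) R s z).encard ≤ (3 * M : ℕ) := by
  have hinj : Set.InjOn (A.lab s) (F.nbrsNear (A.joined β) R s z) :=
    fun u hu u' hu' h => A.lab_inj s u u' hu.1 hu'.1 h
  rw [← hinj.encard_image]
  have hsub : A.lab s '' F.nbrsNear (A.joined β) R s z ⊆
      {l | Near A.K₀ R ((F.g s).symm z) (A.att l)} ∪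
        ({l | Near A.K₀ R ((F.g s).symm (β true)) (A.att l)} ∪
          {l | Near A.K₀ R ((F.g s).symm (β false)) (A.att l)}) := by
    rintro _ ⟨u, ⟨-, hu⟩, rfl⟩
    have key : ∀ {c}, Near A.K₀ R (F.g s (A.att (A.lab s u))) c →
        Near A.K₀ R ((F.g s).symm c) (A.att (A.lab s u)) := fun {c} h => by
      have := (h.iso (F.g s).symm).symm
      rwa [RelIso.symm_apply_apply] at this
    exact (near_of_near_joined hu).imp key (Or.imp key key)
  refine (Set.encard_le_encard hsub).trans ((Set.encard_union_le _ _).trans ?_)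
  refine (add_le_add (hM _) ((Set.encard_union_le _ _).trans (add_le_add (hM _) (hM _)))).trans ?_
  norm_cast
  omega

theorem le_encard_nbrsNear {R : ℕ} {n : Bool → ℕ}
    (hn : ∀ z, (n (A.sideV z) : ℕ∞) ≤ {l | Near A.K₀ R z (A.att l)}.encard)
    (s : W) (z : V) (hz : A.sideV z = A.sideW s) :
    (n (A.sideW s) : ℕ∞) ≤ (F.nbrsNear A.K₀ R s z).encard := by
  have h1 := hn ((F.g s).symm z)
  have hside : A.sideV ((F.g s).symm z) = A.sideW s := by
    rw [← F.side_g s, RelIso.apply_symm_apply, hz]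
  rw [hside] at h1
  refine h1.trans ((Set.encard_le_encard ?_).trans (Set.encard_image_le (A.lab s) _))
  intro l hl
  have h2 := side_of_near hl
  rw [hside, A.side_att] at h2
  obtain ⟨u, hu, rfl⟩ := A.lab_surj s l h2.symm
  refine ⟨u, ⟨hu, ?_⟩, rfl⟩
  have := (Near.iso (F.g s) hl).symm
  rwa [RelIso.apply_symm_apply] at this

theorem mem_childrenNear {R : ℕ} {e v : {t // F.top t}} {z : V} :
    v ∈ F.pieceTree.childrenNear (A.joined β) R e z ↔ (v : W) ≠ F.r ∧ F.up (F.par v) = e ∧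
      Near (A.joined β) R (F.g (F.par v) (A.att (A.lab (F.par v) v))) z := by
  refine and_congr ?_ (and_congr ?_ Iff.rfl)
  · exact not_congr Subtype.ext_iff
  · exact Subtype.ext_iff

theorem image_childrenNear_subset (R : ℕ) (e : {t // F.top t}) (z : V) :
    Subtype.val '' F.pieceTree.childrenNear (A.joined β) R e z ⊆
      F.nbrsNear (A.joined β) R e z ∪ F.nbrsNear (A.joined β) R (F.m e) z := by
  rintro _ ⟨v, hv, rfl⟩
  obtain ⟨h1, h2, h3⟩ := F.mem_childrenNear.1 hv
  have hadj := (F.isParentMap.adj v h1).symm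
  rcases F.eq_or_eq_m_up (F.par v) with h | h
  · rw [h2] at h
    exact Or.inl ⟨h ▸ hadj, h ▸ h3⟩
  · rw [h2] at h
    exact Or.inr ⟨h ▸ hadj, h ▸ h3⟩

/-- The three removed nodes are the parent of `e` and the two ends of the matching edge, each seen
as a neighbour of the other. Any remaining neighbour is a child and is `top`: below `e` because it
is not the partner, below `F.m e` because `F.m e` is not `top`. -/
theorem subset_image_childrenNear (R : ℕ) (e : {t // F.top t}) (z : V) :
    (F.nbrsNear (A.joined β) R e z ∪ F.nbrsNear (A.joined β) R (F.m e) z) \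
      {F.par e, F.m e, (e : W)} ⊆
      Subtype.val '' F.pieceTree.childrenNear (A.joined β) R e z := by
  rintro u ⟨hu, hne⟩
  simp only [Set.mem_insert_iff, Set.mem_singleton_iff, not_or] at hne
  obtain ⟨hne1, hne2, hne3⟩ := hne
  rcases hu with ⟨hu, hnear⟩ | ⟨hu, hnear⟩
  · obtain ⟨h1, h2⟩ := F.isParentMap.par_eq _ _ hu (Or.inr hne1)
    have ht : F.top u := by
      rw [F.top_iff u h1, h2]
      exact fun h => hne2 h.2
    refine ⟨⟨u, ht⟩, F.mem_childrenNear.2 ⟨h1, ?_, ?_⟩, rfl⟩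
    · simp only [h2]; exact up_of_top e.2
    · simp only [h2]; exact hnear
  · obtain ⟨h1, h2⟩ := F.isParentMap.par_eq _ _ hu (Or.inr (by rw [F.par_m]; exact hne3))
    have ht : F.top u := by
      rw [F.top_iff u h1, h2]
      exact fun h => not_top_m e.2 h.1
    refine ⟨⟨u, ht⟩, F.mem_childrenNear.2 ⟨h1, ?_, ?_⟩, rfl⟩
    · simp only [h2]; exact up_m e.2
    · simp only [h2]; exact hnear

/-- If the part on the side of `s` already offers five labels, nothing is needed from `s'`.
Otherwise that part has diameter at most `R`, so neighbours of `s'` attached within `R` of its base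
point are within `R + 1 + R` of `z`, and both sides count. -/
theorem le_encard_union (hβ : ∀ i, A.sideV (β i) = i) {R : ℕ} {n : Bool → ℕ}
    (hn : ∀ z, (n (A.sideV z) : ℕ∞) ≤ {l | Near A.K₀ R z (A.att l)}.encard)
    (hn5 : 5 ≤ n true + n false)
    (hdiam : ∀ i, 5 ≤ n i ∨ ∀ y z, A.sideV y = i → A.sideV z = i → Near A.K₀ R y z)
    {s s' : W} (hs : A.T.Adj s s') (z : V) (hz : A.sideV z = A.sideW s) :
    5 ≤ (F.nbrsNear (A.joined β) (2 * R + 1) s z ∪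
      F.nbrsNear (A.joined β) (2 * R + 1) s' z).encard := by
  have h1 : (n (A.sideW s) : ℕ∞) ≤ (F.nbrsNear (A.joined β) (2 * R + 1) s z).encard :=
    (F.le_encard_nbrsNear hn s z hz).trans (Set.encard_le_encard fun u hu =>
      ⟨hu.1, (near_joined hu.2).mono (by omega)⟩)
  rcases hdiam (A.sideW s) with h | h
  · exact (le_trans (by exact_mod_cast h) h1).trans (Set.encard_le_encard Set.subset_union_left)
  · have h2 : (n (A.sideW s') : ℕ∞) ≤ (F.nbrsNear (A.joined β) (2 * R + 1) s' z).encard := by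
      refine (F.le_encard_nbrsNear hn s' (β (A.sideW s')) (hβ _)).trans
        (Set.encard_le_encard fun u hu => ⟨hu.1, ?_⟩)
      have h3 : Near A.K₀ R (β (A.sideW s)) z := h _ _ (hβ _) hz
      exact (((near_joined hu.2).trans (near_base (A.sideW s') (A.sideW s))).trans
        (near_joined h3)).mono (by omega)
    rw [Set.encard_union_eq]
    · refine le_trans ?_ (add_le_add h1 h2)
      have h4 := A.side_adj _ _ hs
      have h5 : n (A.sideW s) + n (A.sideW s') = n true + n false := by
        rw [h4]
        cases A.sideW s
        · exact add_comm _ _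
        · rfl
      exact_mod_cast h5 ▸ hn5
    -- Neighbours of adjacent nodes lie on opposite sides of the bipartition.
    · rw [Set.disjoint_left]
      rintro u ⟨hu, -⟩ ⟨hu', -⟩
      have h4 := A.side_adj _ _ hs
      have h5 := A.side_adj _ _ hu
      have h6 := A.side_adj _ _ hu'
      rw [h5, h4] at h6
      revert h6
      cases A.sideW s <;> simp

theorem uniformlyAttached (h : A.Tame β) : F.pieceTree.UniformlyAttached (A.joined β) := by
  constructor
  · obtain ⟨n, R, -, hn5, hn, hdiam⟩ := h.le_count
    refine ⟨2 * R + 1, fun e z => ?_⟩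
    have h5 : 5 ≤ (F.nbrsNear (A.joined β) (2 * R + 1) e z ∪
        F.nbrsNear (A.joined β) (2 * R + 1) (F.m e) z).encard := by
      by_cases hz : A.sideV z = A.sideW e
      · exact F.le_encard_union h.side_base hn hn5 hdiam (F.m_adj e) z hz
      · rw [Set.union_comm]
        refine F.le_encard_union h.side_base hn hn5 hdiam (F.m_adj e).symm z ?_
        rw [side_m]
        revert hz
        cases A.sideV z <;> cases A.sideW (e : W) <;> simp
    rw [← Subtype.val_injective.encard_image]
    refine le_trans ?_ (Set.encard_le_encard (F.subset_image_childrenNear _ e z))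
    -- Five neighbours minus these three leave the two children required; this is the origin of the
    -- bound `5`.
    have h3 : ({F.par e, F.m e, (e : W)} : Set W).encard ≤ 3 := by
      refine (Set.encard_insert_le _ _).trans ?_
      refine (add_le_add (Set.encard_insert_le _ _) le_rfl).trans ?_
      rw [Set.encard_singleton]
      norm_num
    have h6 := h5.trans (Set.encard_le_encard_sdiff_add_encard _ {F.par e, F.m e, (e : W)})
    have h7 := h6.trans (add_le_add le_rfl h3)
    have h8 : (2 : ℕ∞) + 3 ≤ _ := le_trans (by norm_num) h7
    exact (ENat.add_le_add_iff_right (by simp)).1 h8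
  · intro R
    obtain ⟨M, hM⟩ := h.count_le R
    refine ⟨3 * M + 3 * M, fun e z => ?_⟩
    rw [← Subtype.val_injective.encard_image]
    refine (Set.encard_le_encard (F.image_childrenNear_subset R e z)).trans
      ((Set.encard_union_le _ _).trans ?_)
    exact (add_le_add (F.encard_nbrsNear_le hM _ _) (F.encard_nbrsNear_le hM _ _)).trans
      (by norm_cast)

end Framing

/-- A tree of spaces over a tame graph is coarsely equivalent to a uniformly attached piece tree. -/
theorem Tame.exists_pieceTree (h : A.Tame β) : ∃ (N : Type u) (Z : PieceTree N V),
    Z.UniformlyAttached (A.joined β) ∧ CoarseEquiv A.Q (Z.graph (A.joined β) (β true)) := by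
  obtain ⟨F⟩ := h.exists_framing
  exact ⟨_, F.pieceTree, F.uniformlyAttached h, F.coarseEquiv h.side_base⟩

end SpaceTree

/-! ### Quasi-transitive graphs -/

theorem exists_uniform_bound {α : Type*} {s : Set α} (hs : s.Finite) {P : ℕ → α → Prop}
    (hP : ∀ m n x, m ≤ n → P m x → P n x) (h : ∀ x ∈ s, ∃ n, P n x) : ∃ n, ∀ x ∈ s, P n x := by
  induction s, hs using Set.Finite.induction_on with
  | empty => exact ⟨0, by simp⟩
  | insert _ _ ih =>
    obtain ⟨n, hn⟩ := ih fun x hx => h x (Or.inr hx)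
    obtain ⟨m, hm⟩ := h _ (Or.inl rfl)
    refine ⟨max m n, ?_⟩
    rintro x (rfl | hx)
    · exact hP _ _ _ (le_max_left _ _) hm
    · exact hP _ _ _ (le_max_right _ _) (hn x hx)

section Factor

variable {V : Type u} {ι : Type v} {G : SimpleGraph V} {S : ι → Set V}

theorem IsQuasiTransitive.exists_align (hq : IsQuasiTransitive G) (hc : G.Preconnected) (b : V) :
    ∃ C, ∀ z, ∃ g : G ≃g G, Near G C (g z) b := by
  obtain ⟨R, hR, h⟩ := hq
  obtain ⟨C, hC⟩ := exists_uniform_bound hR (P := fun n r => Near G n r b)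
    (fun m n x hmn hx => hx.mono hmn) (fun r _ => exists_near_of_reachable (hc r b))
  refine ⟨C, fun z => ?_⟩
  obtain ⟨r, hr, g, rfl⟩ := h z
  exact ⟨g.symm, by rw [RelIso.symm_apply_apply]; exact hC r hr⟩

theorem exists_near_of_finite {s : Set V} (hs : s.Finite) (hc : G.Preconnected) :
    ∃ D, ∀ x ∈ s, ∀ y ∈ s, Near G D x y := by
  obtain ⟨D, hD⟩ := exists_uniform_bound (hs.prod hs) (P := fun n p => Near G n p.1 p.2)
    (fun m n x hmn hx => hx.mono hmn) (fun p _ => exists_near_of_reachable (hc p.1 p.2))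
  exact ⟨D, fun x hx y hy => hD (x, y) ⟨hx, hy⟩⟩

theorem ActsQuasiTransitivelyOn.exists_diam (hS : ActsQuasiTransitivelyOn G S)
    (hc : G.Preconnected) (hfin : ∀ k, (S k).Finite) :
    ∃ D, ∀ k, ∀ x ∈ S k, ∀ y ∈ S k, Near G D x y := by
  obtain ⟨Γ, -, -, K, hK, h⟩ := hS
  obtain ⟨D, hD⟩ := exists_uniform_bound hK (P := fun n k => ∀ x ∈ S k, ∀ y ∈ S k, Near G n x y)
    (fun m n k hmn hk x hx y hy => (hk x hx y hy).mono hmn)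
    (fun k _ => exists_near_of_finite (hfin k) hc)
  refine ⟨D, fun k => ?_⟩
  obtain ⟨r, hr, g, -, hg⟩ := h k
  rw [← hg]
  rintro _ ⟨x, hx, rfl⟩ _ ⟨y, hy, rfl⟩
  exact (hD r hr x hx y hy).iso g

/-- The translates of a single adhesion set under `Γ` are again adhesion sets and come close to
every vertex; the uniform diameter bound allows passing to the chosen points `P k`. -/
theorem ActsQuasiTransitivelyOn.exists_dense (hS : ActsQuasiTransitivelyOn G S)
    (hc : G.Preconnected) (hfin : ∀ k, (S k).Finite) [Nonempty ι] {P : ι → V}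
    (hP : ∀ k, P k ∈ S k) : ∃ R, ∀ x, ∃ k, Near G R x (P k) := by
  obtain ⟨D, hD⟩ := hS.exists_diam hc hfin
  obtain ⟨Γ, ⟨R, hR, hRt⟩, hperm, -⟩ := hS
  obtain ⟨k₀⟩ := ‹Nonempty ι›
  obtain ⟨C, hC⟩ := exists_uniform_bound hR (P := fun n r => Near G n r (P k₀))
    (fun m n x hmn hx => hx.mono hmn) (fun r _ => exists_near_of_reachable (hc r _))
  refine ⟨C + D, fun x => ?_⟩
  obtain ⟨r, hr, g, hg, rfl⟩ := hRt x
  obtain ⟨k, hk⟩ := hperm g hg k₀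
  have h1 : g (P k₀) ∈ S k := hk ▸ Set.mem_image_of_mem g (hP k₀)
  exact ⟨k, ((hC r hr).iso g).trans (hD k _ h1 _ (hP k))⟩

theorem IsLocallyFinite.finite_near (hl : IsLocallyFinite G) (n : ℕ) (x : V) :
    {y | Near G n x y}.Finite := by
  induction n generalizing x with
  | zero => simp [near_zero_iff]
  | succ n ih =>
    refine (((hl x).biUnion fun z _ => ih z).union (Set.finite_singleton x)).subset ?_
    intro y hy
    rcases near_succ_iff.1 hy with rfl | ⟨z, hz, h⟩
    · exact Or.inr rfl
    · exact Or.inl (Set.mem_biUnion hz h)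

theorem IsQuasiTransitive.exists_encard_near_le (hq : IsQuasiTransitive G)
    (hl : IsLocallyFinite G) (n : ℕ) : ∃ M : ℕ, ∀ x, {y | Near G n x y}.encard ≤ M := by
  obtain ⟨R, hR, h⟩ := hq
  obtain ⟨M, hM⟩ := exists_uniform_bound hR
    (P := fun (m : ℕ) r => {y | Near G n r y}.encard ≤ m)
    (fun m n x hmn hx => hx.trans (by exact_mod_cast hmn))
    (fun r _ => ⟨_, (hl.finite_near n r).cast_ncard_eq.ge⟩)
  refine ⟨M, fun x => ?_⟩
  obtain ⟨r, hr, g, rfl⟩ := h x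
  refine le_trans ?_ (hM r hr)
  rw [← g.symm.injective.encard_image]
  refine Set.encard_le_encard ?_
  rintro _ ⟨y, hy, rfl⟩
  have := Near.iso g.symm hy
  rwa [RelIso.symm_apply_apply] at this

theorem encard_biUnion_le {α β : Type*} {s : Set α} (hs : s.Finite) (f : α → Set β) {N : ℕ}
    (hf : ∀ a ∈ s, (f a).encard ≤ N) : (⋃ a ∈ s, f a).encard ≤ s.encard * N := by
  induction s, hs using Set.Finite.induction_on with
  | empty => simp
  | insert ha _ ih =>
    rw [Set.biUnion_insert, Set.encard_insert_of_notMem ha, add_mul, one_mul, add_comm]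
    exact (Set.encard_union_le _ _).trans
      (add_le_add (hf _ (Or.inl rfl)) (ih fun b hb => hf b (Or.inr hb)))

theorem exists_encard_near_index_le (hq : IsQuasiTransitive G) (hl : IsLocallyFinite G)
    {P : ι → V} {N : ℕ} (hN : ∀ y, {k | P k = y}.encard ≤ N) (n : ℕ) :
    ∃ M : ℕ, ∀ x, {k | Near G n x (P k)}.encard ≤ M := by
  obtain ⟨M, hM⟩ := hq.exists_encard_near_le hl n
  refine ⟨M * N, fun x => ?_⟩
  have h1 : {k | Near G n x (P k)} ⊆ ⋃ y ∈ {y | Near G n x y}, {k | P k = y} := fun k hk =>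
    Set.mem_biUnion (x := P k) hk rfl
  refine (Set.encard_le_encard h1).trans
    ((encard_biUnion_le (hl.finite_near n x) _ fun y _ => hN y).trans ?_)
  push_cast
  gcongr
  exact hM x

/-- Balls are finite, so some vertex lies outside; a walk from it to `x` enters the ball through an
edge whose outer end is the required vertex. -/
theorem exists_near_not_near [Infinite V] (hc : G.Connected) (hl : IsLocallyFinite G) (n : ℕ)
    (x : V) : ∃ y, Near G (n + 1) x y ∧ ¬ Near G n x y := by
  obtain ⟨y, hy⟩ := (hl.finite_near n x).infinite_compl.nonempty
  obtain ⟨k, hk⟩ := exists_near_of_reachable (hc.preconnected x y)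
  induction k generalizing y with
  | zero => exact absurd (hk.mono (Nat.zero_le n)) hy
  | succ k ih =>
    rcases near_succ_iff.1 hk.symm with rfl | ⟨z, hz, h⟩
    · exact absurd (Near.refl _) hy
    · by_cases hzn : Near G n x z
      · exact ⟨y, hzn.trans (Near.of_adj hz.symm), hy⟩
      · exact ih z hzn h.symm

/-- Coarsely dense points in an infinite graph: every large ball contains many of them. -/
theorem exists_le_encard_near [Infinite V] (hc : G.Connected) (hl : IsLocallyFinite G) {P : ι → V}
    {R : ℕ} (hR : ∀ x, ∃ k, Near G R x (P k)) (n : ℕ) :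
    ∃ r, ∀ x, (n : ℕ∞) ≤ {k | Near G r x (P k)}.encard := by
  induction n with
  | zero => exact ⟨0, by simp⟩
  | succ n ih =>
    obtain ⟨r, hr⟩ := ih
    refine ⟨r + R + 1 + R, fun x => ?_⟩
    -- A point `P k` within `R` of a vertex outside radius `r + R` is outside radius `r`, hence not
    -- yet counted.
    obtain ⟨y, hy, hy'⟩ := exists_near_not_near hc hl (r + R) x
    obtain ⟨k, hk⟩ := hR y
    have hkn : k ∉ {k | Near G r x (P k)} := fun h => hy' (Near.trans h hk.symm)
    have hsub : insert k {k | Near G r x (P k)} ⊆ {k | Near G (r + R + 1 + R) x (P k)} := by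
      rintro j (rfl | hj)
      · exact hy.trans hk
      · exact Near.mono hj (by omega)
    refine le_trans ?_ (Set.encard_le_encard hsub)
    rw [Set.encard_insert_of_notMem hkn]
    push_cast
    gcongr
    exact hr x

/-- Around each vertex there are at least `n` of the points `P k` at bounded distance, where either
`5 ≤ n` or the graph has bounded diameter. -/
theorem exists_le_count (hc : G.Connected) (hl : IsLocallyFinite G) {P : ι → V} {R : ℕ}
    (hR : ∀ x, ∃ k, Near G R x (P k)) {m : ℕ} (hm5 : m ≤ 5)
    (hm : (m : ℕ∞) ≤ (Set.univ : Set ι).encard) :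
    ∃ n r, m ≤ n ∧ (∀ x, (n : ℕ∞) ≤ {k | Near G r x (P k)}.encard) ∧
      (5 ≤ n ∨ ∀ x y, Near G r x y) := by
  cases finite_or_infinite V
  · obtain ⟨D, hD⟩ := exists_near_of_finite (Set.finite_univ (α := V)) hc.preconnected
    refine ⟨m, D, le_rfl, fun x => ?_, Or.inr fun x y => hD x trivial y trivial⟩
    rwa [show {k | Near G D x (P k)} = Set.univ from
      Set.eq_univ_of_forall fun k => hD x trivial _ trivial]
  · obtain ⟨r, hr⟩ := exists_le_encard_near hc hl hR 5
    exact ⟨5, r, hm5, fun x => by exact_mod_cast hr x, Or.inl le_rfl⟩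

end Factor

/-! ### Semiregular trees with infinitely many ends -/

theorem two_le_encard_of_ray {W : Type u} {T : SimpleGraph W} (r : Ray T) (n : ℕ) :
    2 ≤ (T.neighborSet (r.toFun (n + 1))).encard := by
  have h : ({r.toFun n, r.toFun (n + 2)} : Set W) ⊆ T.neighborSet (r.toFun (n + 1)) := by
    rintro _ (rfl | rfl)
    · exact (r.adj n).symm
    · exact r.adj (n + 1)
  refine le_trans ?_ (Set.encard_le_encard h)
  rw [Set.encard_pair (fun e => by have := r.inj e; omega)]

/-- The ray obtained by deleting the first `n` vertices of a ray. -/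
def Ray.drop {W : Type u} {T : SimpleGraph W} (r : Ray T) (n : ℕ) : Ray T where
  toFun k := r.toFun (k + n)
  inj a b h := by have := r.inj h; omega
  adj k := by
    have := r.adj (k + n)
    rwa [Nat.add_right_comm] at this

theorem Ray.equiv_of_drop {W : Type u} {T : SimpleGraph W} {r s : Ray T} {m n : ℕ}
    (h : ∀ k, r.toFun (k + m) = s.toFun (k + n)) : r.Equiv s := by
  intro S hS
  obtain ⟨N, hN⟩ := Ray.Equiv.refl s S hS
  refine ⟨N + m + n, fun a ha b hb => ?_⟩
  have h1 := h (a - m)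
  rw [Nat.sub_add_cancel (by omega)] at h1
  obtain ⟨h2, h3, h4⟩ := hN (a - m + n) (by omega) b (by omega)
  simp only [h1]
  exact ⟨h2, h3, h4⟩

theorem Ray.next_eq {W : Type u} {T : SimpleGraph W}
    (h2 : ∀ t, (T.neighborSet t).encard = 2) {r : Ray T} {n : ℕ} {t : W}
    (ht : T.Adj (r.toFun (n + 1)) t) : t = r.toFun n ∨ t = r.toFun (n + 2) := by
  have h : ({r.toFun n, r.toFun (n + 2)} : Set W) ⊆ T.neighborSet (r.toFun (n + 1)) := by
    rintro _ (rfl | rfl)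
    · exact (r.adj n).symm
    · exact r.adj (n + 1)
  have hcard : ({r.toFun n, r.toFun (n + 2)} : Set W).encard = 2 :=
    Set.encard_pair (fun e => by have := r.inj e; omega)
  have := (Set.toFinite _).eq_of_subset_of_encard_le h (by rw [h2, hcard])
  have ht' : t ∈ T.neighborSet (r.toFun (n + 1)) := ht
  rw [← this] at ht'
  simpa using ht'

/-- In a connected graph in which all vertices have degree `2`, every ray has a tail that is a tail
of a ray starting at a given vertex. -/
theorem exists_ray_from {W : Type u} {T : SimpleGraph W} (hT : T.Connected)
    (h2 : ∀ t, (T.neighborSet t).encard = 2) (s : Ray T) (o : W) :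
    ∃ r : Ray T, r.toFun 0 = o ∧ r.Equiv s := by
  obtain ⟨n, hn⟩ := exists_near_of_reachable (hT.preconnected o (s.toFun 0))
  induction n generalizing o with
  | zero => exact ⟨s, (near_zero_iff.1 hn).symm, Ray.Equiv.refl s⟩
  | succ n ih =>
    rcases near_succ_iff.1 hn with h | ⟨z, hz, h⟩
    · exact ⟨s, h.symm, Ray.Equiv.refl s⟩
    · obtain ⟨r, rfl, hr⟩ := ih z h
      by_cases h1 : o = r.toFun 1
      · refine ⟨r.drop 1, by simp [Ray.drop, h1], ?_⟩
        exact (raySetoid T).trans (Ray.equiv_of_drop (m := 0) (n := 1) fun k => rfl) hr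
      -- If `o` were a later vertex of `r`, its two neighbours would be its neighbours on `r`, and
      -- `r.toFun 0` is among them only when `o` is `r.toFun 1`.
      · have hnot : ∀ k, r.toFun k ≠ o := by
          intro k hk
          subst hk
          cases k with
          | zero => exact hz.ne rfl
          | succ k =>
            rcases Ray.next_eq h2 hz with h3 | h3
            · have := r.inj h3
              subst this
              exact h1 rfl
            · have := r.inj h3
              omega
        let q : Ray T :=
          { toFun := fun k => k.casesOn o (fun k => r.toFun k)
            inj := by
              intro a b hab
              cases a <;> cases b
              · rfl
              · exact absurd hab.symm (hnot _)
              · exact absurd hab (hnot _)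
              · exact congrArg _ (r.inj hab)
            adj := by
              intro k
              cases k
              · exact hz
              · exact r.adj _ }
        exact ⟨q, rfl, (raySetoid T).trans
          (Ray.equiv_of_drop (m := 1) (n := 0) fun k => rfl) hr⟩

/-- Every end has a ray from `o`, and with all degrees `2` such a ray is determined by its first
step. -/
theorem finite_ends_of_degree_two {W : Type u} {T : SimpleGraph W} (hT : T.Connected)
    (h2 : ∀ t, (T.neighborSet t).encard = 2) : Finite (Ends T) := by
  obtain ⟨o⟩ := hT.nonempty
  have hex : ∀ ε : Ends T, ∃ r : Ray T, r.toFun 0 = o ∧ (Quotient.mk (raySetoid T) r) = ε := by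
    intro ε
    obtain ⟨s, rfl⟩ := Quotient.exists_rep ε
    obtain ⟨r, h0, hr⟩ := exists_ray_from hT h2 s o
    exact ⟨r, h0, Quotient.sound hr⟩
  choose ρ hρ₀ hρ using hex
  have hfin : (T.neighborSet o).Finite := Set.finite_of_encard_eq_coe (k := 2) (h2 o)
  have := hfin.to_subtype
  refine Finite.of_injective (β := T.neighborSet o)
    (fun ε => ⟨(ρ ε).toFun 1, by have := (ρ ε).adj 0; rwa [hρ₀] at this⟩) ?_
  intro ε ε' h
  have h1 : (ρ ε).toFun 1 = (ρ ε').toFun 1 := congrArg Subtype.val h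
  have hall : ∀ k, (ρ ε).toFun k = (ρ ε').toFun k ∧
      (ρ ε).toFun (k + 1) = (ρ ε').toFun (k + 1) := by
    intro k
    induction k with
    | zero => exact ⟨by rw [hρ₀, hρ₀], h1⟩
    | succ k ih =>
      refine ⟨ih.2, ?_⟩
      have h3 := (ρ ε).adj (k + 1)
      rw [ih.2] at h3
      rcases Ray.next_eq h2 h3 with h4 | h4
      · rw [← ih.1] at h4
        have := (ρ ε).inj h4
        omega
      · exact h4
  rw [← hρ ε, ← hρ ε']
  exact Quotient.sound (Ray.equiv_of_drop (m := 0) (n := 0) fun k => (hall k).1)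

/-- The degrees of a semiregular tree with infinitely many ends. -/
theorem IsSemiregularTree.degrees {W : Type u} {T : SimpleGraph W} {A : Set W} {p₁ p₂ : ℕ∞}
    (hT : IsSemiregularTree T A p₁ p₂) (he : Infinite (Ends T)) :
    2 ≤ p₁ ∧ 2 ≤ p₂ ∧ ¬ (p₁ = 2 ∧ p₂ = 2) := by
  obtain ⟨ε⟩ := he.nonempty
  -- Two consecutive inner vertices of a ray have degree at least `2` and lie in different classes
  -- of the bipartition.
  obtain ⟨r, -⟩ := Quotient.exists_rep ε
  have h1 := two_le_encard_of_ray r 0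
  have h2 := two_le_encard_of_ray r 1
  have hb := hT.bipartite _ _ (r.adj 1)
  refine ⟨?_, ?_, ?_⟩
  · by_cases h : r.toFun 1 ∈ A
    · rwa [hT.degree₁ _ h] at h1
    · have h' : r.toFun (1 + 1) ∈ A := by
        by_contra h'
        exact h (hb.2 h')
      rwa [hT.degree₁ _ h'] at h2
  · by_cases h : r.toFun 1 ∈ A
    · rwa [hT.degree₂ _ (hb.1 h)] at h2
    · rwa [hT.degree₂ _ h] at h1
  · rintro ⟨rfl, rfl⟩
    refine (not_finite_iff_infinite.2 he) (finite_ends_of_degree_two hT.isTree.connected fun t => ?_)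
    by_cases h : t ∈ A
    · exact hT.degree₁ t h
    · exact hT.degree₂ t h

/-! ### Tree amalgamations as trees of spaces -/

theorem le_encard_univ_label {p : ℕ∞} {m : ℕ} (h : (m : ℕ∞) ≤ p) :
    (m : ℕ∞) ≤ (Set.univ : Set (Label p)).encard := by
  let f : Fin m → Label p := fun i => ⟨i, lt_of_lt_of_le (by exact_mod_cast i.2) h⟩
  have hf : Injective f := fun i j hij => Fin.ext (congrArg Subtype.val hij)
  have := Set.encard_le_encard (Set.subset_univ (Set.range f))
  rw [← Set.image_univ, hf.encard_image] at this
  simpa using this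

section Sum

variable {V₁ : Type u} {V₂ : Type v} {G₁ : SimpleGraph V₁} {G₂ : SimpleGraph V₂}

theorem near_sum_inl_iff {n : ℕ} {x : V₁} {z : V₁ ⊕ V₂} :
    Near (G₁ ⊕g G₂) n (Sum.inl x) z ↔ ∃ y, z = Sum.inl y ∧ Near G₁ n x y := by
  constructor
  · induction n generalizing x with
    | zero => exact fun h => ⟨x, (near_zero_iff.1 h).symm, Near.refl x⟩
    | succ n ih =>
      intro h
      rcases near_succ_iff.1 h with rfl | ⟨c, hc, h'⟩
      · exact ⟨x, rfl, Near.refl x⟩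
      · cases c with
        | inl c =>
          obtain ⟨y, rfl, hy⟩ := ih h'
          exact ⟨y, rfl, near_succ_iff.2 (Or.inr ⟨c, hc, hy⟩)⟩
        | inr c => exact absurd hc (by simp)
  · rintro ⟨y, rfl, h⟩
    simpa using h.map (H := G₁ ⊕g G₂) Sum.inl (C := 1) (fun a b hab => Near.of_adj hab)

theorem near_sum_inr_iff {n : ℕ} {x : V₂} {z : V₁ ⊕ V₂} :
    Near (G₁ ⊕g G₂) n (Sum.inr x) z ↔ ∃ y, z = Sum.inr y ∧ Near G₂ n x y := by
  constructor
  · induction n generalizing x with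
    | zero => exact fun h => ⟨x, (near_zero_iff.1 h).symm, Near.refl x⟩
    | succ n ih =>
      intro h
      rcases near_succ_iff.1 h with rfl | ⟨c, hc, h'⟩
      · exact ⟨x, rfl, Near.refl x⟩
      · cases c with
        | inr c =>
          obtain ⟨y, rfl, hy⟩ := ih h'
          exact ⟨y, rfl, near_succ_iff.2 (Or.inr ⟨c, hc, hy⟩)⟩
        | inl c => exact absurd hc (by simp)
  · rintro ⟨y, rfl, h⟩
    simpa using h.map (H := G₁ ⊕g G₂) Sum.inr (C := 1) (fun a b hab => Near.of_adj hab)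

end Sum

namespace AmalgamationData

variable {V₁ : Type u} {V₂ : Type v} {W : Type w} {G₁ : SimpleGraph V₁} {G₂ : SimpleGraph V₂}
  {T : SimpleGraph W} {A : Set W} {p₁ p₂ : ℕ∞} (X : AmalgamationData G₁ G₂ T A p₁ p₂)

/-- The vertex of `G₁` or `G₂` of which the given vertex is a copy. -/
def val : X.CopyVertex → V₁ ⊕ V₂ := Sum.map Prod.snd Prod.snd

open Classical in
/-- The label at `s` of the edge `st`. -/
noncomputable def lab [Nonempty (Label p₁ ⊕ Label p₂)] (s t : W) : Label p₁ ⊕ Label p₂ :=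
  if h : T.Adj s t then
    if s ∈ A then Sum.inl (X.c ⟨s(s, t), h⟩).1 else Sum.inr (X.c ⟨s(s, t), h⟩).2
  else Classical.arbitrary _

/-- The adhesion sets of `G₁` and of `G₂`. -/
def adh : Label p₁ ⊕ Label p₂ → Set (V₁ ⊕ V₂) :=
  Sum.elim (fun k => Sum.inl '' X.S₁ k) (fun l => Sum.inr '' X.S₂ l)

variable {X}

theorem newEdges_adj_inl_inr {s : A} {x : V₁} {t : ↥Aᶜ} {y : V₂} :
    X.newEdges.Adj (Sum.inl (s, x)) (Sum.inr (t, y)) ↔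
      ∃ (h : T.Adj s t) (hx : x ∈ X.S₁ (X.c ⟨s(↑s, ↑t), h⟩).1),
        (X.φ (X.c ⟨s(↑s, ↑t), h⟩).1 (X.c ⟨s(↑s, ↑t), h⟩).2 ⟨x, hx⟩ : V₂) = y := by
  rw [newEdges, SimpleGraph.fromRel_adj]
  constructor
  · rintro ⟨-, ⟨s', x', t', y', h1, h2, h⟩ | ⟨s', x', t', y', h1, h2, h⟩⟩
    · obtain ⟨rfl, rfl⟩ := Prod.ext_iff.1 (Sum.inl_injective h1)
      obtain ⟨rfl, rfl⟩ := Prod.ext_iff.1 (Sum.inr_injective h2)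
      exact h
    · exact absurd h1 (by simp)
  · intro h
    exact ⟨by simp, Or.inl ⟨s, x, t, y, rfl, rfl, h⟩⟩

theorem newEdges_cases {a b : X.CopyVertex} (h : X.newEdges.Adj a b) :
    (∃ s x t y, a = Sum.inl (s, x) ∧ b = Sum.inr (t, y)) ∨
      ∃ s x t y, b = Sum.inl (s, x) ∧ a = Sum.inr (t, y) := by
  obtain ⟨-, ⟨s, x, t, y, h1, h2, -⟩ | ⟨s, x, t, y, h1, h2, -⟩⟩ :=
    (SimpleGraph.fromRel_adj _ _ _).1 h
  · exact Or.inl ⟨s, x, t, y, h1, h2⟩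
  · exact Or.inr ⟨s, x, t, y, h1, h2⟩

section

variable [Nonempty (Label p₁ ⊕ Label p₂)]

theorem lab_of_mem {s t : W} (h : T.Adj s t) (hs : s ∈ A) :
    X.lab s t = Sum.inl (X.c ⟨s(s, t), h⟩).1 := by
  simp [lab, h, hs]

theorem lab_of_notMem {s t : W} (h : T.Adj s t) (hs : s ∉ A) :
    X.lab s t = Sum.inr (X.c ⟨s(s, t), h⟩).2 := by
  simp [lab, h, hs]

theorem lab_inj {s t t' : W} (h : T.Adj s t) (h' : T.Adj s t') (e : X.lab s t = X.lab s t') :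
    t = t' := by
  have key : (⟨⟨s(s, t), h⟩, Sym2.mem_mk_left s t⟩ : {e : T.edgeSet // s ∈ (e : Sym2 W)}) =
      ⟨⟨s(s, t'), h'⟩, Sym2.mem_mk_left s t'⟩ := by
    by_cases hs : s ∈ A
    · rw [lab_of_mem h hs, lab_of_mem h' hs] at e
      exact (X.c_bijective₁ s hs).1 (Sum.inl_injective e)
    · rw [lab_of_notMem h hs, lab_of_notMem h' hs] at e
      exact (X.c_bijective₂ s hs).1 (Sum.inr_injective e)
  exact Sym2.congr_right.1 (congrArg (fun e => (e.1 : Sym2 W)) key)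

theorem exists_lab_eq_inl {s : W} (hs : s ∈ A) (k : Label p₁) :
    ∃ t, T.Adj s t ∧ X.lab s t = Sum.inl k := by
  obtain ⟨⟨⟨e, he⟩, hse⟩, h⟩ := (X.c_bijective₁ s hs).2 k
  change (X.c ⟨e, he⟩).1 = k at h
  obtain ⟨t, rfl⟩ := hse
  exact ⟨t, he, by rw [lab_of_mem he hs]; exact congrArg _ h⟩

theorem exists_lab_eq_inr {s : W} (hs : s ∉ A) (k : Label p₂) :
    ∃ t, T.Adj s t ∧ X.lab s t = Sum.inr k := by
  obtain ⟨⟨⟨e, he⟩, hse⟩, h⟩ := (X.c_bijective₂ s hs).2 k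
  change (X.c ⟨e, he⟩).2 = k at h
  obtain ⟨t, rfl⟩ := hse
  exact ⟨t, he, by rw [lab_of_notMem he hs]; exact congrArg _ h⟩

theorem newEdges_adj_spec {a b : X.CopyVertex} (h : X.newEdges.Adj a b) :
    T.Adj (X.node a) (X.node b) ∧ X.val a ∈ X.adh (X.lab (X.node a) (X.node b)) := by
  rcases newEdges_cases h with ⟨s, x, t, y, rfl, rfl⟩ | ⟨s, x, t, y, rfl, rfl⟩
  · obtain ⟨hst, hx, -⟩ := newEdges_adj_inl_inr.1 h
    refine ⟨hst, ?_⟩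
    change Sum.inl x ∈ X.adh (X.lab s t)
    rw [lab_of_mem hst s.2]
    exact ⟨x, hx, rfl⟩
  · obtain ⟨hst, hx, rfl⟩ := newEdges_adj_inl_inr.1 h.symm
    refine ⟨hst.symm, ?_⟩
    change Sum.inr _ ∈ X.adh (X.lab t s)
    rw [lab_of_notMem hst.symm t.2]
    refine ⟨_, ?_, rfl⟩
    have e : (⟨s(↑t, ↑s), hst.symm⟩ : T.edgeSet) = ⟨s(↑s, ↑t), hst⟩ := Subtype.ext Sym2.eq_swap
    rw [e]
    exact Subtype.coe_prop _

theorem exists_newEdges_adj (hb : ∀ s t, T.Adj s t → (s ∈ A ↔ t ∉ A)) {a : X.CopyVertex} {t : W}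
    (h : T.Adj (X.node a) t) (ha : X.val a ∈ X.adh (X.lab (X.node a) t)) :
    ∃ b, X.node b = t ∧ X.newEdges.Adj a b := by
  rcases a with ⟨s, x⟩ | ⟨s, y⟩
  · change T.Adj s t at h
    change Sum.inl x ∈ X.adh (X.lab s t) at ha
    rw [lab_of_mem h s.2] at ha
    obtain ⟨x', hx, e⟩ := ha
    obtain rfl := Sum.inl_injective e
    exact ⟨Sum.inr (⟨t, (hb _ _ h).1 s.2⟩, _), rfl, newEdges_adj_inl_inr.2 ⟨h, hx, rfl⟩⟩
  · change T.Adj s t at h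
    change Sum.inr y ∈ X.adh (X.lab s t) at ha
    rw [lab_of_notMem h s.2] at ha
    obtain ⟨y', hy, e⟩ := ha
    obtain rfl := Sum.inr_injective e
    have ht : t ∈ A := (hb _ _ h.symm).2 s.2
    have e : (⟨s(↑s, t), h⟩ : T.edgeSet) = ⟨s(t, ↑s), h.symm⟩ := Subtype.ext Sym2.eq_swap
    rw [e] at hy
    refine ⟨Sum.inl (⟨t, ht⟩, (X.φ (X.c ⟨s(t, ↑s), h.symm⟩).1
      (X.c ⟨s(t, ↑s), h.symm⟩).2).symm ⟨y', hy⟩), rfl, ?_⟩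
    refine (newEdges_adj_inl_inr.2 ⟨h.symm, Subtype.coe_prop _, ?_⟩).symm
    simp

end

theorem newEdges_adj_node {a b : X.CopyVertex} (h : X.newEdges.Adj a b) :
    T.Adj (X.node a) (X.node b) := by
  rcases newEdges_cases h with ⟨s, x, t, y, rfl, rfl⟩ | ⟨s, x, t, y, rfl, rfl⟩
  · exact (newEdges_adj_inl_inr.1 h).1
  · exact (newEdges_adj_inl_inr.1 h.symm).1.symm

theorem newEdges_adj_unique {a b b' : X.CopyVertex} (h : X.newEdges.Adj a b)
    (h' : X.newEdges.Adj a b') (hn : X.node b = X.node b') : b = b' := by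
  rcases newEdges_cases h with ⟨s, x, t, y, rfl, rfl⟩ | ⟨s, x, t, y, rfl, rfl⟩
  · rcases newEdges_cases h' with ⟨s', x', t', y', e, rfl⟩ | ⟨s', x', t', y', rfl, e⟩
    · obtain rfl : t = t' := Subtype.ext hn
      obtain ⟨h1, h2, rfl⟩ := newEdges_adj_inl_inr.1 h
      obtain ⟨h3, h4, rfl⟩ := newEdges_adj_inl_inr.1 h'
      rfl
    · exact absurd e (by simp)
  · rcases newEdges_cases h' with ⟨s', x', t', y', e, rfl⟩ | ⟨s', x', t', y', rfl, e⟩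
    · exact absurd e (by simp)
    · obtain rfl : s = s' := Subtype.ext hn
      obtain ⟨h1, h2, h5⟩ := newEdges_adj_inl_inr.1 h.symm
      obtain ⟨h3, h4, h6⟩ := newEdges_adj_inl_inr.1 h'.symm
      have := (X.φ _ _).injective (Subtype.ext (h5.trans h6.symm))
      rw [Subtype.mk.injEq] at this
      rw [this]

/-- Vertices that are identified are joined by new edges along the path in `T` between their
nodes. -/
theorem near_newEdges (hT : T.IsTree) {a b : X.CopyVertex} (h : X.newEdges.Reachable a b) :
    ∃ p : X.newEdges.Walk a b, p.length = T.dist (X.node a) (X.node b) := by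
  obtain ⟨q⟩ := h
  induction q with
  | nil => exact ⟨Walk.nil, by simp⟩
  | @cons a c b hac q ih =>
    obtain ⟨p, hp⟩ := ih
    have hnode := newEdges_adj_node hac
    rcases hT.dist_eq_dist_add_one_of_adj (X.node b) hnode with h1 | h1
    · refine ⟨Walk.cons hac p, ?_⟩
      rw [Walk.length_cons, hp, dist_comm, dist_comm (u := X.node a), h1]
    -- Here `a` is closer to `b` than `c` is. The first step of `p` also goes closer, so it leads to
    -- the same node as `a`, and a new edge at `c` is determined by the node at its other end: the
    -- walk backtracks and two edges cancel.
    · cases p with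
      | nil => rw [dist_self] at h1; omega
      | @cons _ c' _ hcc p =>
        have hn' := newEdges_adj_node hcc
        rw [Walk.length_cons] at hp
        have hle : T.dist (X.node b) (X.node c') ≤ p.length := by
          have := (near_iff_exists_walk.2 ⟨p, le_rfl⟩ : Near X.newEdges p.length c' b)
          have := (this.map (H := T) X.node (C := 1)
            fun x y hxy => Near.of_adj (newEdges_adj_node hxy)).symm.dist_le
          omega
        rw [dist_comm] at hp
        have h2 : T.dist (X.node b) (X.node c) = T.dist (X.node b) (X.node c') + 1 := by
          rcases hT.dist_eq_dist_add_one_of_adj (X.node b) hn' with h2 | h2 <;> omega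
        have h3 := eq_of_adj_of_dist hT hnode.symm hn' h1 h2
        obtain rfl : a = c' := newEdges_adj_unique hac.symm hcc h3
        refine ⟨p, ?_⟩
        rw [dist_comm]
        omega

theorem FiniteIdentification.exists_bound (h : X.FiniteIdentification) : ∃ N : ℕ,
    ∀ x, ∃ U : Set W, (T.induce U).IsTree ∧ U.encard ≤ N ∧ X.ObtainedWithin x U := by
  obtain ⟨N, hN⟩ := h
  refine ⟨N, fun x => ?_⟩
  have hx := hN x
  unfold identificationSize at hx
  have hne : {n | ∃ U : Set W, (T.induce U).IsTree ∧ U.encard = n ∧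
      X.ObtainedWithin x U}.Nonempty := by
    by_contra hne
    rw [Set.not_nonempty_iff_eq_empty.1 hne, sInf_empty] at hx
    exact absurd hx (by simp)
  obtain ⟨U, hU, hn, hx'⟩ := csInf_mem hne
  exact ⟨U, hU, hn ▸ hx, hx'⟩

theorem dist_le_of_induce_connected {U : Set W} (hU : (T.induce U).Connected) {N : ℕ}
    (hN : U.encard ≤ N) {s t : W} (hs : s ∈ U) (ht : t ∈ U) : T.dist s t ≤ N := by
  have hfin : U.Finite := Set.finite_of_encard_le_coe hN
  have := hfin.fintype
  obtain ⟨p, hp⟩ := (hU.preconnected ⟨s, hs⟩ ⟨t, ht⟩).exists_isPath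
  have h1 := hp.length_lt
  have h2 : Fintype.card U ≤ N := by
    have : (Fintype.card U : ℕ∞) ≤ N := by
      rwa [← Set.coe_fintypeCard] at hN
    exact_mod_cast this
  have h3 := T.dist_le (p.map (SimpleGraph.Embedding.induce U).toHom)
  rw [Walk.length_map] at h3
  exact h3.trans (by omega)

theorem FiniteIdentification.exists_near (h : X.FiniteIdentification) (hT : T.IsTree) :
    ∃ N, ∀ a b, X.ψ a = X.ψ b → Near X.newEdges N a b := by
  obtain ⟨N, hN⟩ := h.exists_bound
  refine ⟨N, fun a b hab => ?_⟩
  obtain ⟨U, hU, hUN, hx⟩ := hN (X.ψ a)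
  obtain ⟨ha, hb, -⟩ := hx a b rfl hab.symm
  obtain ⟨p, hp⟩ := near_newEdges hT (ConnectedComponent.exact hab)
  exact near_iff_exists_walk.2 ⟨p, hp.le.trans (dist_le_of_induce_connected hU.connected hUN ha hb)⟩

/-- Each adhesion set containing a vertex identifies a copy of it with a vertex at a different
neighbouring node, and all these nodes lie in the bounded subtree. -/
theorem FiniteIdentification.exists_encard_adh_le [Nonempty (Label p₁ ⊕ Label p₂)]
    (h : X.FiniteIdentification) (hb : ∀ s t, T.Adj s t → (s ∈ A ↔ t ∉ A))
    (hA : A.Nonempty) (hA' : Aᶜ.Nonempty) :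
    ∃ N : ℕ, ∀ z, {l | z ∈ X.adh l}.encard ≤ N := by
  obtain ⟨N, hN⟩ := h.exists_bound
  refine ⟨N, fun z => ?_⟩
  have hz : ∃ a : X.CopyVertex, X.val a = z ∧
      ∀ l, z ∈ X.adh l → ∃ t, T.Adj (X.node a) t ∧ X.lab (X.node a) t = l := by
    obtain ⟨s, hs⟩ := hA
    obtain ⟨t, ht⟩ := hA'
    cases z with
    | inl x =>
      refine ⟨Sum.inl (⟨s, hs⟩, x), rfl, fun l hl => ?_⟩
      cases l with
      | inl k => exact exists_lab_eq_inl hs k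
      | inr k =>
        obtain ⟨_, _, e⟩ := hl
        exact absurd e (by simp)
    | inr y =>
      refine ⟨Sum.inr (⟨t, ht⟩, y), rfl, fun l hl => ?_⟩
      cases l with
      | inr k => exact exists_lab_eq_inr ht k
      | inl k =>
        obtain ⟨_, _, e⟩ := hl
        exact absurd e (by simp)
  obtain ⟨a, rfl, hl⟩ := hz
  obtain ⟨U, -, hUN, hU⟩ := hN (X.ψ a)
  have hsub : {l | X.val a ∈ X.adh l} ⊆ X.lab (X.node a) '' U := by
    intro l hal
    obtain ⟨t, ht, rfl⟩ := hl l hal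
    obtain ⟨b, rfl, hab⟩ := exists_newEdges_adj hb ht hal
    obtain ⟨-, hbU, -⟩ := hU a b rfl (ConnectedComponent.sound hab.symm.reachable)
    exact ⟨_, hbU, rfl⟩
  exact (Set.encard_le_encard hsub).trans ((Set.encard_image_le _ _).trans hUN)

theorem copies_adj_iff {a b : X.CopyVertex} :
    X.copies.Adj a b ↔ X.node a = X.node b ∧ (G₁ ⊕g G₂).Adj (X.val a) (X.val b) := by
  rcases a with ⟨s, x⟩ | ⟨s, x⟩ <;> rcases b with ⟨t, y⟩ | ⟨t, y⟩ <;>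
    simp [copies, node, val, Subtype.ext_iff, and_comm]

/-- Contracting the new edges is a coarse equivalence. -/
theorem coarseEquiv_sumGraph (hT : T.IsTree) (h : X.FiniteIdentification) :
    CoarseEquiv X.amalgam X.sumGraph := by
  obtain ⟨N, hN⟩ := h.exists_near hT
  have hN' : ∀ a b, X.ψ a = X.ψ b → Near X.sumGraph N a b := fun a b hab =>
    (hN a b hab).anti le_sup_right
  have hout : ∀ x : X.Vertex, ∃ a, X.ψ a = x := fun x => x.exists_rep
  choose k hk using hout
  -- An edge of the amalgamation comes from some edge of `X.sumGraph`, but its ends may differ from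
  -- the chosen representatives by `N` each.
  refine ⟨k, X.ψ, N + 1 + N, ?_, ?_, fun x => Near.of_eq (hk x), fun a => ?_⟩
  · rintro _ _ ⟨-, a, b, rfl, rfl, hab⟩
    exact ((hN' _ _ (hk _)).trans (Near.of_adj hab)).trans (hN' _ _ (hk _).symm)
  · intro a b hab
    by_cases he : X.ψ a = X.ψ b
    · exact Near.of_eq he
    · exact (Near.of_adj (G := X.amalgam) ⟨he, a, b, rfl, rfl, hab⟩).mono (by omega)
  · exact (hN' _ _ (hk _)).mono (by omega)

end AmalgamationData

/-! ### Tameness of the tree of spaces of an amalgamation. -/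

namespace AmalgamationData

variable {V₁ : Type u} {V₂ : Type v} {W : Type w} {G₁ : SimpleGraph V₁} {G₂ : SimpleGraph V₂}
  {T : SimpleGraph W} {A : Set W} {p₁ p₂ : ℕ∞} (X : AmalgamationData G₁ G₂ T A p₁ p₂)

/-- A point of each adhesion set. -/
noncomputable def pt : Label p₁ ⊕ Label p₂ → V₁ ⊕ V₂ :=
  Sum.map (fun k => (X.nonempty₁ k).some) (fun l => (X.nonempty₂ l).some)

theorem pt_mem (l : Label p₁ ⊕ Label p₂) : X.pt l ∈ X.adh l := by
  cases l with
  | inl k => exact ⟨_, (X.nonempty₁ k).some_mem, rfl⟩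
  | inr k => exact ⟨_, (X.nonempty₂ k).some_mem, rfl⟩

theorem exists_adh_diam (hq : X.QuasiTransitiveAdhesion) (ha : X.FiniteAdhesion)
    (h₁ : G₁.Preconnected) (h₂ : G₂.Preconnected) :
    ∃ D, ∀ l, ∀ y ∈ X.adh l, ∀ z ∈ X.adh l, Near (G₁ ⊕g G₂) D y z := by
  obtain ⟨D₁, hD₁⟩ := hq.1.exists_diam h₁ ha.1
  obtain ⟨D₂, hD₂⟩ := hq.2.exists_diam h₂ ha.2
  refine ⟨max D₁ D₂, ?_⟩
  rintro (k | k)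
  · rintro _ ⟨x, hx, rfl⟩ _ ⟨y, hy, rfl⟩
    exact near_sum_inl_iff.2 ⟨y, rfl, (hD₁ k x hx y hy).mono (le_max_left _ _)⟩
  · rintro _ ⟨x, hx, rfl⟩ _ ⟨y, hy, rfl⟩
    exact near_sum_inr_iff.2 ⟨y, rfl, (hD₂ k x hx y hy).mono (le_max_right _ _)⟩

open Classical in
/-- The graph `G₁ + G₂` as a tree of spaces. -/
noncomputable def spaceTree [Nonempty (Label p₁ ⊕ Label p₂)] (hT : T.IsTree)
    (hb : ∀ s t, T.Adj s t → (s ∈ A ↔ t ∉ A)) {D : ℕ}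
    (hD : ∀ l, ∀ y ∈ X.adh l, ∀ z ∈ X.adh l, Near (G₁ ⊕g G₂) D y z) :
    SpaceTree W (V₁ ⊕ V₂) (Label p₁ ⊕ Label p₂) X.CopyVertex where
  T := T
  K₀ := G₁ ⊕g G₂
  Q := X.sumGraph
  D := D
  sideW s := decide (s ∈ A)
  sideV := Sum.isLeft
  sideL := Sum.isLeft
  att := X.pt
  lab := X.lab
  node := X.node
  val := X.val
  isTree := hT
  side_adj s t h := by
    have := hb s t h
    by_cases hs : s ∈ A
    · simp [hs, this.1 hs]
    · have ht : t ∈ A := by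
        by_contra ht
        exact hs (this.2 ht)
      simp [hs, ht]
  side_K₀ y z h := by
    rcases y with y | y <;> rcases z with z | z
    · rfl
    · exact absurd h (by simp)
    · exact absurd h (by simp)
    · rfl
  side_att l := by cases l <;> rfl
  side_lab s t h := by
    by_cases hs : s ∈ A
    · simp [lab_of_mem h hs, hs]
    · simp [lab_of_notMem h hs, hs]
  lab_inj s t t' h h' e := lab_inj h h' e
  lab_surj s l h := by
    cases l with
    | inl k => exact exists_lab_eq_inl (by simpa using h.symm) k
    | inr k => exact exists_lab_eq_inr (by simpa using h.symm) k
  side_val a := by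
    rcases a with ⟨s, x⟩ | ⟨s, x⟩
    · simp [val, node]
    · have hs : (s : W) ∉ A := s.2
      simp [val, node, hs]
  exists_point t z h := by
    cases z with
    | inl x => exact ⟨Sum.inl (⟨t, by simpa using h.symm⟩, x), rfl, rfl⟩
    | inr x => exact ⟨Sum.inr (⟨t, by simpa using h.symm⟩, x), rfl, rfl⟩
  point_ext a b hn hv := by
    rcases a with ⟨s, x⟩ | ⟨s, x⟩ <;> rcases b with ⟨t, y⟩ | ⟨t, y⟩
    · obtain rfl : s = t := Subtype.ext hn
      obtain rfl : x = y := Sum.inl_injective hv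
      rfl
    · exact absurd hv (by simp [val])
    · exact absurd hv (by simp [val])
    · obtain rfl : s = t := Subtype.ext hn
      obtain rfl : x = y := Sum.inr_injective hv
      rfl
  adj_cases a b h := by
    rcases h with h | h
    · exact Or.inl (copies_adj_iff.1 h)
    · obtain ⟨h1, h2⟩ := newEdges_adj_spec h
      obtain ⟨-, h3⟩ := newEdges_adj_spec h.symm
      exact Or.inr ⟨h1, hD _ _ h2 _ (X.pt_mem _), hD _ _ h3 _ (X.pt_mem _)⟩
  adj_copy a b hn h := Or.inl (copies_adj_iff.2 ⟨hn, h⟩)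
  exists_adj s t h := by
    obtain ⟨a, rfl, ha⟩ : ∃ a : X.CopyVertex, X.node a = s ∧ X.val a = X.pt (X.lab s t) := by
      by_cases hs : s ∈ A
      · rw [lab_of_mem h hs]
        exact ⟨Sum.inl (⟨s, hs⟩, _), rfl, rfl⟩
      · rw [lab_of_notMem h hs]
        exact ⟨Sum.inr (⟨s, hs⟩, _), rfl, rfl⟩
    obtain ⟨b, rfl, hab⟩ := exists_newEdges_adj hb h (ha ▸ X.pt_mem _)
    exact ⟨a, b, rfl, rfl, Or.inr hab, ha,
      hD _ _ (newEdges_adj_spec hab.symm).2 _ (X.pt_mem _)⟩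

/-- The base points of the two factors. -/
def base (b₁ : V₁) (b₂ : V₂) (i : Bool) : V₁ ⊕ V₂ := cond i (Sum.inl b₁) (Sum.inr b₂)

/-- Alignment is quasi-transitivity of the factors, applied on one summand at a time. The upper
count combines finite balls with bounded membership in adhesion sets; the lower count comes from
density of the adhesion sets when a factor is infinite and from the degrees of the tree when it is
finite. -/
theorem tame_spaceTree [Nonempty (Label p₁ ⊕ Label p₂)] (hT : IsSemiregularTree T A p₁ p₂)
    (he : Infinite (Ends T)) (hc₁ : G₁.Connected) (hq₁ : IsQuasiTransitive G₁)
    (hl₁ : IsLocallyFinite G₁) (hc₂ : G₂.Connected) (hq₂ : IsQuasiTransitive G₂)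
    (hl₂ : IsLocallyFinite G₂) (hXq : X.QuasiTransitiveAdhesion) (hXa : X.FiniteAdhesion)
    (hXi : X.FiniteIdentification) (b₁ : V₁) (b₂ : V₂) {D : ℕ}
    (hD : ∀ l, ∀ y ∈ X.adh l, ∀ z ∈ X.adh l, Near (G₁ ⊕g G₂) D y z) :
    (X.spaceTree hT.isTree hT.bipartite hD).Tame (base b₁ b₂) := by
  obtain ⟨hp₁, hp₂, hp⟩ := hT.degrees he
  have hne₁ : Nonempty (Label p₁) :=
    ⟨⟨0, lt_of_lt_of_le (by norm_num) hp₁⟩⟩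
  have hne₂ : Nonempty (Label p₂) :=
    ⟨⟨0, lt_of_lt_of_le (by norm_num) hp₂⟩⟩
  let P₁ : Label p₁ → V₁ := fun k => (X.nonempty₁ k).some
  let P₂ : Label p₂ → V₂ := fun k => (X.nonempty₂ k).some
  have hP₁ : ∀ k, P₁ k ∈ X.S₁ k := fun k => (X.nonempty₁ k).some_mem
  have hP₂ : ∀ k, P₂ k ∈ X.S₂ k := fun k => (X.nonempty₂ k).some_mem
  have set₁ : ∀ R x, {l | Near (G₁ ⊕g G₂) R (Sum.inl x) (X.pt l)} =
      Sum.inl '' {k | Near G₁ R x (P₁ k)} := by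
    intro R x
    ext l
    simp only [Set.mem_ofPred_eq, near_sum_inl_iff, Set.mem_image]
    constructor
    · rintro ⟨y, hy, h⟩
      cases l with
      | inl k =>
        obtain rfl : P₁ k = y := Sum.inl_injective hy
        exact ⟨k, h, rfl⟩
      | inr k => exact absurd hy (by simp [pt])
    · rintro ⟨k, h, rfl⟩
      exact ⟨P₁ k, rfl, h⟩
  have set₂ : ∀ R x, {l | Near (G₁ ⊕g G₂) R (Sum.inr x) (X.pt l)} =
      Sum.inr '' {k | Near G₂ R x (P₂ k)} := by
    intro R x
    ext l
    simp only [Set.mem_ofPred_eq, near_sum_inr_iff, Set.mem_image]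
    constructor
    · rintro ⟨y, hy, h⟩
      cases l with
      | inr k =>
        obtain rfl : P₂ k = y := Sum.inr_injective hy
        exact ⟨k, h, rfl⟩
      | inl k => exact absurd hy (by simp [pt])
    · rintro ⟨k, h, rfl⟩
      exact ⟨P₂ k, rfl, h⟩
  have hAne : A.Nonempty ∧ Aᶜ.Nonempty := by
    obtain ⟨ε⟩ := he.nonempty
    obtain ⟨r, -⟩ := Quotient.exists_rep ε
    have := hT.bipartite _ _ (r.adj 0)
    by_cases h : r.toFun 0 ∈ A
    · exact ⟨⟨_, h⟩, ⟨_, this.1 h⟩⟩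
    · refine ⟨⟨r.toFun (0 + 1), ?_⟩, ⟨_, h⟩⟩
      by_contra h'
      exact h (this.2 h')
  constructor
  · intro i
    cases i <;> rfl
  · obtain ⟨C₁, hC₁⟩ := hq₁.exists_align hc₁.preconnected b₁
    obtain ⟨C₂, hC₂⟩ := hq₂.exists_align hc₂.preconnected b₂
    refine ⟨max C₁ C₂, ?_⟩
    rintro (x | x)
    · obtain ⟨g, hg⟩ := hC₁ x
      refine ⟨Iso.sumCongr g Iso.refl, ?_,
        near_sum_inl_iff.2 ⟨b₁, rfl, hg.mono (le_max_left _ _)⟩⟩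
      rintro (y | y) <;> rfl
    · obtain ⟨g, hg⟩ := hC₂ x
      refine ⟨Iso.sumCongr Iso.refl g, ?_,
        near_sum_inr_iff.2 ⟨b₂, rfl, hg.mono (le_max_right _ _)⟩⟩
      rintro (y | y) <;> rfl
  · intro R
    obtain ⟨N, hN⟩ := hXi.exists_encard_adh_le hT.bipartite hAne.1 hAne.2
    have hN₁ : ∀ y, {k | P₁ k = y}.encard ≤ N := by
      intro y
      rw [← Sum.inl_injective.encard_image]
      refine (Set.encard_le_encard ?_).trans (hN (Sum.inl y))
      rintro _ ⟨k, rfl, rfl⟩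
      exact X.pt_mem (Sum.inl k)
    have hN₂ : ∀ y, {k | P₂ k = y}.encard ≤ N := by
      intro y
      rw [← Sum.inr_injective.encard_image]
      refine (Set.encard_le_encard ?_).trans (hN (Sum.inr y))
      rintro _ ⟨k, rfl, rfl⟩
      exact X.pt_mem (Sum.inr k)
    obtain ⟨M₁, hM₁⟩ := exists_encard_near_index_le hq₁ hl₁ hN₁ R
    obtain ⟨M₂, hM₂⟩ := exists_encard_near_index_le hq₂ hl₂ hN₂ R
    refine ⟨max M₁ M₂, ?_⟩
    rintro (x | x)
    · change {l | Near (G₁ ⊕g G₂) R (Sum.inl x) (X.pt l)}.encard ≤ _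
      rw [set₁, Sum.inl_injective.encard_image]
      exact (hM₁ x).trans (by exact_mod_cast le_max_left _ _)
    · change {l | Near (G₁ ⊕g G₂) R (Sum.inr x) (X.pt l)}.encard ≤ _
      rw [set₂, Sum.inr_injective.encard_image]
      exact (hM₂ x).trans (by exact_mod_cast le_max_right _ _)
  · obtain ⟨R₁, hR₁⟩ := hXq.1.exists_dense hc₁.preconnected hXa.1 hP₁
    obtain ⟨R₂, hR₂⟩ := hXq.2.exists_dense hc₂.preconnected hXa.2 hP₂
    -- Both degrees are at least `2` and one is at least `3`, which gives the total of `5` even if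
    -- both factors are finite.
    have hm : ∃ m₁ m₂ : ℕ, 2 ≤ m₁ ∧ 2 ≤ m₂ ∧ m₁ ≤ 5 ∧ m₂ ≤ 5 ∧ 5 ≤ m₁ + m₂ ∧
        (m₁ : ℕ∞) ≤ p₁ ∧ (m₂ : ℕ∞) ≤ p₂ := by
      have h3 : ∀ p : ℕ∞, 2 ≤ p → p ≠ 2 → ((3 : ℕ) : ℕ∞) ≤ p := by
        intro p h2 hne
        have h := Order.add_one_le_of_lt (lt_of_le_of_ne h2 hne.symm)
        exact le_trans (by norm_num) h
      by_cases h : p₁ = 2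
      · exact ⟨2, 3, by norm_num, by norm_num, by norm_num, by norm_num, by norm_num, hp₁,
          h3 p₂ hp₂ fun h' => hp ⟨h, h'⟩⟩
      · exact ⟨3, 2, by norm_num, by norm_num, by norm_num, by norm_num, by norm_num,
          h3 p₁ hp₁ h, hp₂⟩
    obtain ⟨m₁, m₂, h1, h2, h3, h4, h5, h6, h7⟩ := hm
    obtain ⟨n₁, r₁, hmn₁, hn₁, hd₁⟩ := exists_le_count hc₁ hl₁ hR₁ h3 (le_encard_univ_label h6)
    obtain ⟨n₂, r₂, hmn₂, hn₂, hd₂⟩ := exists_le_count hc₂ hl₂ hR₂ h4 (le_encard_univ_label h7)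
    refine ⟨fun i => cond i n₁ n₂, max r₁ r₂, ?_, ?_, ?_, ?_⟩
    · intro i
      cases i
      · exact h2.trans hmn₂
      · exact h1.trans hmn₁
    · change 5 ≤ n₁ + n₂
      omega
    · rintro (x | x)
      · change (n₁ : ℕ∞) ≤ {l | Near (G₁ ⊕g G₂) (max r₁ r₂) (Sum.inl x) (X.pt l)}.encard
        rw [set₁, Sum.inl_injective.encard_image]
        exact (hn₁ x).trans (Set.encard_le_encard fun k hk => Near.mono hk (le_max_left _ _))
      · change (n₂ : ℕ∞) ≤ {l | Near (G₁ ⊕g G₂) (max r₁ r₂) (Sum.inr x) (X.pt l)}.encard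
        rw [set₂, Sum.inr_injective.encard_image]
        exact (hn₂ x).trans (Set.encard_le_encard fun k hk => Near.mono hk (le_max_right _ _))
    · intro i
      cases i
      · refine hd₂.imp id fun h => ?_
        rintro (y | y) (z | z) hy hz
        · exact absurd hy (by simp [spaceTree])
        · exact absurd hy (by simp [spaceTree])
        · exact absurd hz (by simp [spaceTree])
        · exact near_sum_inr_iff.2 ⟨z, rfl, (h y z).mono (le_max_right _ _)⟩
      · refine hd₁.imp id fun h => ?_
        rintro (y | y) (z | z) hy hz
        · exact near_sum_inl_iff.2 ⟨z, rfl, (h y z).mono (le_max_left _ _)⟩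
        · exact absurd hz (by simp [spaceTree])
        · exact absurd hy (by simp [spaceTree])
        · exact absurd hy (by simp [spaceTree])

/-- A tree amalgamation of finite adhesion, finite identification and quasi-transitive adhesion
over a tree with infinitely many ends is coarsely equivalent to a uniformly attached tree of copies
of its two factors joined by an edge between arbitrary base points. -/
theorem exists_pieceTree (hT : IsSemiregularTree T A p₁ p₂)
    (he : Infinite (Ends T)) (hc₁ : G₁.Connected) (hq₁ : IsQuasiTransitive G₁)
    (hl₁ : IsLocallyFinite G₁) (hc₂ : G₂.Connected) (hq₂ : IsQuasiTransitive G₂)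
    (hl₂ : IsLocallyFinite G₂) (hXq : X.QuasiTransitiveAdhesion) (hXa : X.FiniteAdhesion)
    (hXi : X.FiniteIdentification) (b₁ : V₁) (b₂ : V₂) :
    ∃ (N : Type w) (Z : PieceTree N (V₁ ⊕ V₂)),
      Z.UniformlyAttached ((G₁ ⊕g G₂) ⊔ edge (Sum.inl b₁) (Sum.inr b₂)) ∧
      CoarseEquiv X.amalgam
        (Z.graph ((G₁ ⊕g G₂) ⊔ edge (Sum.inl b₁) (Sum.inr b₂)) (Sum.inl b₁)) := by
  obtain ⟨hp₁, -, -⟩ := hT.degrees he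
  have : Nonempty (Label p₁ ⊕ Label p₂) :=
    ⟨Sum.inl ⟨0, lt_of_lt_of_le (by norm_num) hp₁⟩⟩
  obtain ⟨D, hD⟩ := X.exists_adh_diam hXq hXa hc₁.preconnected hc₂.preconnected
  obtain ⟨N, Z, hZ, hQ⟩ := (X.tame_spaceTree hT he hc₁ hq₁ hl₁ hc₂ hq₂ hl₂ hXq hXa hXi b₁ b₂
    hD).exists_pieceTree
  exact ⟨N, Z, hZ, (coarseEquiv_sumGraph hT.isTree hXi).trans hQ⟩

end AmalgamationData

/-- Joining a fixed graph by an edge preserves coarse equivalences. -/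
theorem IsCoarseEquiv.sum_sup_edge {V V' Z : Type*} {F : SimpleGraph V} {G : SimpleGraph V'}
    {f : V → V'} {g : V' → V} {C : ℕ} (h : IsCoarseEquiv F G f g C) (H : SimpleGraph Z) (x : V)
    (z : Z) :
    IsCoarseEquiv ((F ⊕g H) ⊔ edge (Sum.inl x) (Sum.inr z))
      ((G ⊕g H) ⊔ edge (Sum.inl (f x)) (Sum.inr z)) (Sum.map f id) (Sum.map g id) (C + 1) := by
  have hF : ∀ {n : ℕ} {y y' : V}, Near F n y y' →
      Near ((F ⊕g H) ⊔ edge (Sum.inl x) (Sum.inr z)) n (Sum.inl y) (Sum.inl y') := fun h =>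
    (near_sum_inl_iff.2 ⟨_, rfl, h⟩).anti le_sup_left
  have hG : ∀ {n : ℕ} {y y' : V'}, Near G n y y' →
      Near ((G ⊕g H) ⊔ edge (Sum.inl (f x)) (Sum.inr z)) n (Sum.inl y) (Sum.inl y') := fun h =>
    (near_sum_inl_iff.2 ⟨_, rfl, h⟩).anti le_sup_left
  have eF : Near ((F ⊕g H) ⊔ edge (Sum.inl x) (Sum.inr z)) 1 (Sum.inl x) (Sum.inr z) :=
    Near.of_adj (Or.inr (by simp [edge_adj]))
  have eG : Near ((G ⊕g H) ⊔ edge (Sum.inl (f x)) (Sum.inr z)) 1 (Sum.inl (f x)) (Sum.inr z) :=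
    Near.of_adj (Or.inr (by simp [edge_adj]))
  refine ⟨?_, ?_, ?_, ?_⟩
  · intro a b hab
    rcases hab with hab | hab
    · rcases a with a | a <;> rcases b with b | b
      · exact (hG (h.map_adj a b hab)).mono (by omega)
      · exact absurd hab (by simp)
      · exact absurd hab (by simp)
      · exact (Near.of_adj (Or.inl hab)).mono (by omega)
    · obtain ⟨⟨rfl, rfl⟩ | ⟨rfl, rfl⟩, -⟩ := (edge_adj _ _ _ _).1 hab
      · exact eG.mono (by omega)
      · exact eG.symm.mono (by omega)
  · intro a b hab
    rcases hab with hab | hab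
    · rcases a with a | a <;> rcases b with b | b
      · exact (hF (h.inv_adj a b hab)).mono (by omega)
      · exact absurd hab (by simp)
      · exact absurd hab (by simp)
      · exact (Near.of_adj (Or.inl hab)).mono (by omega)
    · obtain ⟨⟨rfl, rfl⟩ | ⟨rfl, rfl⟩, -⟩ := (edge_adj _ _ _ _).1 hab
      -- The added edge is pulled back to start at `g (f x)`, which is only within `C` of `x`; this
      -- is where `C + 1` is needed.
      · exact (hF (h.left_inv x)).trans eF
      · exact ((hF (h.left_inv x)).trans eF).symm
  · rintro (a | a)
    · exact (hF (h.left_inv a)).mono (by omega)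
    · exact Near.refl _
  · rintro (a | a)
    · exact (hG (h.right_inv a)).mono (by omega)
    · exact Near.refl _

end TreeAmalg

theorem mainTheorem4 {VF VG VH W W' : Type*}
    (F : SimpleGraph VF) (G : SimpleGraph VG) (H : SimpleGraph VH)
    (hFc : F.Connected) (hFq : TreeAmalg.IsQuasiTransitive F) (hFl : TreeAmalg.IsLocallyFinite F)
    (hGc : G.Connected) (hGq : TreeAmalg.IsQuasiTransitive G) (hGl : TreeAmalg.IsLocallyFinite G)
    (hHc : H.Connected) (hHq : TreeAmalg.IsQuasiTransitive H) (hHl : TreeAmalg.IsLocallyFinite H)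
    (T : SimpleGraph W) (A : Set W) (p₁ p₂ : ℕ∞)
    (hT : TreeAmalg.IsSemiregularTree T A p₁ p₂) (hTe : Infinite (TreeAmalg.Ends T))
    (T' : SimpleGraph W') (A' : Set W') (p₁' p₂' : ℕ∞)
    (hT' : TreeAmalg.IsSemiregularTree T' A' p₁' p₂') (hTe' : Infinite (TreeAmalg.Ends T'))
    (hFG : TreeAmalg.QuasiIsometric F G)
    (X : TreeAmalg.AmalgamationData F H T A p₁ p₂)
    (hXq : X.QuasiTransitiveAdhesion) (hXl : TreeAmalg.IsLocallyFinite X.amalgam)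
    (hXa : X.FiniteAdhesion) (hXi : X.FiniteIdentification)
    (Y : TreeAmalg.AmalgamationData G H T' A' p₁' p₂')
    (hYq : Y.QuasiTransitiveAdhesion) (hYl : TreeAmalg.IsLocallyFinite Y.amalgam)
    (hYa : Y.FiniteAdhesion) (hYi : Y.FiniteIdentification) :
    TreeAmalg.QuasiIsometric X.amalgam Y.amalgam := by
  obtain ⟨f, g, C, hfg⟩ := hFG.coarseEquiv hFc.preconnected hGc.preconnected
  obtain ⟨b₁⟩ := hFc.nonempty
  obtain ⟨b₂⟩ := hHc.nonempty
  obtain ⟨N, Z, hZ, hXZ⟩ := X.exists_pieceTree hT hTe hFc hFq hFl hHc hHq hHl hXq hXa hXi b₁ b₂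
  -- Base points are arbitrary, so `f b₁` may be used in `G`; the coarse equivalence of the joined
  -- graphs then matches base points exactly, with `D = 0`.
  obtain ⟨N', Z', hZ', hYZ⟩ :=
    Y.exists_pieceTree hT' hTe' hGc hGq hGl hHc hHq hHl hYq hYa hYi (f b₁) b₂
  have hpre : Y.amalgam.Preconnected := hYZ.preconnected
    (Z'.graph_preconnected _ _ (hGc.preconnected.sum_sup_edge hHc.preconnected))
  exact ((hXZ.trans (hZ.coarseEquiv (D := 0) (hfg.sum_sup_edge H b₁ b₂) hZ'
    (TreeAmalg.Near.refl _))).trans hYZ.symm).quasiIsometric hpre
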